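/- Let $k\in L_{1,loc}([0,\infty))$ be nonnegative, nonincreasing and completely monotone (that is, $k\in C^\infty((0,\infty))$ and $(-1)^jk^{(j)}\ge 0$ on $(0,\infty)$ for all $j\in\mathbb N_0$), and let $l\in L_{1,loc}([0,\infty))$ satisfy $k\ast l=1$ on $(0,\infty)$, where $(k\ast g)(t)=\int_0^t k(t-\tau)g(\tau)\,d\tau$. Let $T>0$ and put $(l\overset{T}{\ast}g)(t)=\int_t^T l(\tau-t)g(\tau)\,d\tau$. Let $\mathcal V,\mathcal H$ be real separable Hilbert spaces with $\mathcal V$ densely and continuously embedded into $\mathcal H$, and identify $\mathcal H$ with its dual, so that $\mathcal V\hookrightarrow\mathcal H\hookrightarrow\mathcal V'$. Let $\mathfrak a:\mathcal V\times\mathcal V\to\mathbb R$ be a symmetric bilinear form such that, with constants $M,\kappa>0$ and $d\ge 0$, $$|\mathfrak a(\tilde v,v)|\le M\|\tilde v\|_{\mathcal V}\|v\|_{\mathcal V},\qquad \mathfrak a(v,v)\ge \kappa\|v\|_{\mathcal V}^2-d\|v\|_{\mathcal H}^2\qquad(\tilde v,v\in\mathcal V).$$ Let $A$ be the (nonnegative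 self-adjoint) operator on $\mathcal H$ with maximal domain associated with the shifted form $\tilde{\mathfrak a}(w,v)=\mathfrak a(w,v)+d\,(w,v)_{\mathcal H}$, that is, $\tilde{\mathfrak a}(w,v)=(Aw,v)_{\mathcal H}$ for $w\in D(A)$, $v\in\mathcal V$, and let $A^{1/2}$ be its nonnegative self-adjoint square root, which is defined on $\mathcal V$. Let $u_0\in\mathcal H$, $f\in L_2((0,T);\mathcal V')$, $w\in L_2((0,T);\mathcal V)$, $u\in L_2((0,T);\mathcal H)$, and suppose that $k\ast u\in C([0,T];\mathcal H)$ with $(k\ast u)|_{t=0}=0$. Suppose that for every $v\in\mathcal V$ $$\frac{d}{dt}\big([k\ast(u-u_0)](t),v\big)_{\mathcal H}+\mathfrak a(w(t),v)=\langle f(t),v\rangle_{\mathcal V'\times\mathcal V}\qquad\text{for a.a. }t\in(0,T),$$ where $d/dt$ is the generalized derivative of real functions on $(0,T)$. Then the second and third integral on the left-hand side below are finite, and $$\begin{aligned} &\int_0^T (w,u)_{\mathcal H}\,dt+\frac12\int_0^T\big[k(T-t)+k(t)\big]\,\big\|(l\overset{T}{\ast}A^{1/2}w)(t)\big\|_{\mathcal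 H}^2\,dt\\ &\quad+\frac12\int_0^T\!\!\int_0^t\frac1s\big[k(s)-k(2s)\big]\,\big\|(l\overset{T}{\ast}A^{1/2}w)(t)-(l\overset{T}{\ast}A^{1/2}w)(t-s)\big\|_{\mathcal H}^2\,ds\,dt\\ &\le\int_0^T(u_0,w)_{\mathcal H}\,dt+\int_0^T\langle l\ast f,w\rangle_{\mathcal V'\times\mathcal V}\,dt+d\int_0^T(w,l\ast w)_{\mathcal H}\,dt. \end{aligned}$$ -/

import Mathlib

open MeasureTheory
open scoped ContDiff

noncomputable section

namespace DualityEstimate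

/-! ### Kernels and convolutions -/

/-- Convolution on the half-line, `(k * g)(t) = ∫₀ᵗ k(t-τ) g(τ) dτ`. -/
def conv {E : Type*} [NormedAddCommGroup E] [NormedSpace ℝ E] (k : ℝ → ℝ) (g : ℝ → E) (t : ℝ) : E :=
  ∫ τ in (0 : ℝ)..t, k (t - τ) • g τ

/-- Dual convolution on `(0, T)`, `∫ₜᵀ k(τ-t) g(τ) dτ`. -/
def dualConv {E : Type*} [NormedAddCommGroup E] [NormedSpace ℝ E] (T : ℝ) (k : ℝ → ℝ) (g : ℝ → E)
    (t : ℝ) : E :=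
  ∫ τ in t..T, k (τ - t) • g τ

/-- `(k, l) ∈ PC`: `k` is locally integrable on `[0, ∞)`, nonnegative and nonincreasing on `(0, ∞)`,
`l` is locally integrable on `[0, ∞)`, and `k * l = 1` as an identity between locally
integrable functions on `(0, ∞)`. -/
structure IsPCPair (k l : ℝ → ℝ) : Prop where
  locallyIntegrable_left : LocallyIntegrableOn k (Set.Ici 0)
  nonneg : ∀ t, 0 < t → 0 ≤ k t
  antitone : AntitoneOn k (Set.Ioi 0)
  locallyIntegrable_right : LocallyIntegrableOn l (Set.Ici 0)
  conv_eq_one : ∀ᵐ t : ℝ, 0 < t → conv k l t = 1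

/-- `k` is completely monotone: `k ∈ C^∞((0, ∞))` and `(-1)^j k^{(j)} ≥ 0` on `(0, ∞)` for all
`j`. -/
structure IsCompletelyMonotone (k : ℝ → ℝ) : Prop where
  contDiffOn : ContDiffOn ℝ ∞ k (Set.Ioi 0)
  sign : ∀ (j : ℕ) (t : ℝ), 0 < t → 0 ≤ (-1 : ℝ) ^ j * iteratedDeriv j k t

/-- `g` is the generalized (distributional) derivative of the real function `F` on `(0, T)`. -/
structure HasGeneralizedDeriv (T : ℝ) (F g : ℝ → ℝ) : Prop where
  locallyIntegrable : LocallyIntegrableOn F (Set.Ioo 0 T)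
  locallyIntegrable_deriv : LocallyIntegrableOn g (Set.Ioo 0 T)
  integral_eq : ∀ φ : ℝ → ℝ, ContDiff ℝ ∞ φ → HasCompactSupport φ → tsupport φ ⊆ Set.Ioo 0 T →
    ∫ t in (0 : ℝ)..T, F t * deriv φ t = - ∫ t in (0 : ℝ)..T, g t * φ t

/-! ### The form and the square root of its operator -/

/-- A nonnegative self-adjoint operator `S` with `S ∘ S = A` (as unbounded operators, i.e. with
`D(S ∘ S) = {x ∈ D(S) | S x ∈ D(S)}`). -/
structure IsNonnegSqrt {H : Type*} [NormedAddCommGroup H] [InnerProductSpace ℝ H] [CompleteSpace H]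
    (A S : H →ₗ.[ℝ] H) : Prop where
  isSelfAdjoint : IsSelfAdjoint S
  nonneg : ∀ x : S.domain, 0 ≤ inner ℝ (S x) (x : H)
  sq_eq : ∀ x y : H, (x, y) ∈ A.graph ↔ ∃ z, (x, z) ∈ S.graph ∧ (z, y) ∈ S.graph

open Classical in
/-- The square root `A^{1/2}`: the nonnegative self-adjoint `S` with `S² = A`
(and `A` itself if there is none). -/
def nonnegSqrt {H : Type*} [NormedAddCommGroup H] [InnerProductSpace ℝ H] [CompleteSpace H]
    (A : H →ₗ.[ℝ] H) : H →ₗ.[ℝ] H :=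
  if h : ∃ S, IsNonnegSqrt A S then h.choose else A

section Form

variable {V H : Type*} [NormedAddCommGroup V] [InnerProductSpace ℝ V]
  [NormedAddCommGroup H] [InnerProductSpace ℝ H]

/-- The shifted form `ã(w, v) = a(w, v) + d (w, v)_H`, where `ι : V → H` is the embedding. -/
def shiftedForm (ι : V →L[ℝ] H) (a : V →L[ℝ] V →L[ℝ] ℝ) (d : ℝ) : V →L[ℝ] V →L[ℝ] ℝ :=
  a + d • (isBoundedBilinearMap_inner (𝕜 := ℝ) (E := H)).toContinuousLinearMap.bilinearComp ι ι

@[simp] lemma shiftedForm_apply (ι : V →L[ℝ] H) (a : V →L[ℝ] V →L[ℝ] ℝ) (d : ℝ) (w v : V) :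
    shiftedForm ι a d w v = a w v + d * inner ℝ (ι w) (ι v) := by
  simp [shiftedForm]

/-- The graph of the operator associated with `b` on `H`: all `(ι w, y)` with
`b(w, v) = (y, v)_H` for all `v ∈ V`. -/
def formGraph (ι : V →L[ℝ] H) (b : V →L[ℝ] V →L[ℝ] ℝ) : Submodule ℝ (H × H) where
  carrier := {p | ∃ w : V, ι w = p.1 ∧ ∀ v : V, b w v = inner ℝ p.2 (ι v)}
  zero_mem' := ⟨0, by simp⟩
  add_mem' := by
    rintro p q ⟨w, hw, h⟩ ⟨w', hw', h'⟩
    exact ⟨w + w', by simp [hw, hw'], fun v => by simp [inner_add_left, h, h']⟩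
  smul_mem' := by
    rintro c p ⟨w, hw, h⟩
    exact ⟨c • w, by simp [hw], fun v => by simp [inner_smul_left, h]⟩

/-- The operator on `H` (with maximal domain) associated with the form `b`. -/
def formOperator (ι : V →L[ℝ] H) (b : V →L[ℝ] V →L[ℝ] ℝ) : H →ₗ.[ℝ] H :=
  (formGraph ι b).toLinearPMap

open Classical in
/-- `A^{1/2} v` for `v ∈ V`, where `A` is the operator associated with the form `b`; the value for
`ι v ∉ D(A^{1/2})` is irrelevant by `mem_domain_nonnegSqrt`. -/
def sqrtApply [CompleteSpace H] (ι : V →L[ℝ] H) (b : V →L[ℝ] V →L[ℝ] ℝ) (v : V) : H :=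
  if h : ι v ∈ (nonnegSqrt (formOperator ι b)).domain then
    nonnegSqrt (formOperator ι b) ⟨ι v, h⟩ else 0

/-- `(u, w)` solves `d/dt ([k * (u - u₀)](t), v)_H + a(w(t), v) = ⟨f(t), v⟩` for all `v ∈ V` and
almost all `t ∈ (0, T)`, with the generalized derivative of real functions on `(0, T)`. -/
def IsWeakSolution (T : ℝ) (ι : V →L[ℝ] H) (a : V →L[ℝ] V →L[ℝ] ℝ) (k : ℝ → ℝ) (u₀ : H)
    (f : ℝ → StrongDual ℝ V) (u : ℝ → H) (w : ℝ → V) : Prop :=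
  ∀ v : V, ∃ g : ℝ → ℝ,
    HasGeneralizedDeriv T (fun t => inner ℝ (conv k (fun τ => u τ - u₀) t) (ι v)) g ∧
    ∀ᵐ t ∂(volume.restrict (Set.Ioo 0 T)), g t + a (w t) v = f t v

/-! ### The square root is well defined on `V` -/

lemma mem_formOperator_graph {ι : V →L[ℝ] H} (hι : DenseRange ι) (hinj : Function.Injective ι)
    (b : V →L[ℝ] V →L[ℝ] ℝ) (x y : H) :
    (x, y) ∈ (formOperator ι b).graph ↔ ∃ w : V, ι w = x ∧ ∀ v : V, b w v = inner ℝ y (ι v) := by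
  rw [formOperator, Submodule.toLinearPMap_graph_eq]
  · rfl
  · rintro ⟨x, y⟩ ⟨w, hw, h⟩ hx
    have hw0 : w = 0 := hinj (by simpa using hw.trans hx)
    subst hw0
    refine hι.eq_zero_of_inner_left ℝ (fun v => ?_)
    simpa using (h v).symm

/-- The coefficients `2 Cₙ / 4ⁿ⁺¹` (`Cₙ` the Catalan numbers) of `1 - √(1 - x) = ∑ cₙ xⁿ⁺¹`. -/
def sqrtCoeff (n : ℕ) : ℝ := 2 * catalan n / 4 ^ (n + 1)

lemma sqrtCoeff_nonneg (n : ℕ) : 0 ≤ sqrtCoeff n := by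
  unfold sqrtCoeff; positivity

lemma sqrtCoeff_eq (n : ℕ) : sqrtCoeff n =
    Nat.centralBinom n / 4 ^ n - Nat.centralBinom (n + 1) / 4 ^ (n + 1) := by
  have h1 : ((n : ℝ) + 1) * catalan n = Nat.centralBinom n := by
    exact_mod_cast succ_mul_catalan_eq_centralBinom n
  have h2 : ((n : ℝ) + 1) * Nat.centralBinom (n + 1) = 2 * (2 * n + 1) * Nat.centralBinom n := by
    exact_mod_cast Nat.succ_mul_centralBinom_succ n
  have h3 : (Nat.centralBinom (n + 1) : ℝ) = 2 * (2 * n + 1) * catalan n := by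
    have : (n : ℝ) + 1 ≠ 0 := by positivity
    apply mul_left_cancel₀ this
    rw [h2, ← h1]; ring
  rw [sqrtCoeff, h3, ← h1, pow_succ]
  field_simp
  ring

lemma sum_sqrtCoeff_le (N : ℕ) : ∑ n ∈ Finset.range N, sqrtCoeff n ≤ 1 := by
  have : ∑ n ∈ Finset.range N, sqrtCoeff n = 1 - Nat.centralBinom N / 4 ^ N := by
    simp_rw [sqrtCoeff_eq]
    rw [Finset.sum_range_sub' (fun n => (Nat.centralBinom n : ℝ) / 4 ^ n)]
    simp
  rw [this]
  have : (0 : ℝ) ≤ Nat.centralBinom N / 4 ^ N := by positivity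
  linarith

lemma summable_sqrtCoeff : Summable sqrtCoeff :=
  summable_of_sum_range_le sqrtCoeff_nonneg sum_sqrtCoeff_le

lemma sum_sqrtCoeff_mul (n : ℕ) :
    ∑ p ∈ Finset.HasAntidiagonal.antidiagonal n, sqrtCoeff p.1 * sqrtCoeff p.2 = 2 * sqrtCoeff (n + 1) := by
  have h : ∀ p ∈ Finset.HasAntidiagonal.antidiagonal n, sqrtCoeff p.1 * sqrtCoeff p.2 =
      4 / 4 ^ (n + 2) * ((catalan p.1 * catalan p.2 : ℕ) : ℝ) := by
    intro p hp
    have hn : n + 2 = (p.1 + 1) + (p.2 + 1) := by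
      have := Finset.HasAntidiagonal.mem_antidiagonal.1 hp
      omega
    rw [hn, pow_add]
    simp only [sqrtCoeff]
    push_cast
    field_simp
    ring
  rw [Finset.sum_congr rfl h, ← Finset.mul_sum, ← Nat.cast_sum, ← catalan_succ', sqrtCoeff]
  ring

/-- A contraction `C = C*` has `1 - C = R²` with `R = R* ≥ 0`. -/
lemma exists_sqrt_one_sub [CompleteSpace H] (C : H →L[ℝ] H) (hC : IsSelfAdjoint C)
    (hC1 : ‖C‖ ≤ 1) : ∃ R : H →L[ℝ] H, IsSelfAdjoint R ∧ (∀ x, 0 ≤ inner ℝ (R x) x) ∧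
      R * R = 1 - C := by
  have hpow : ∀ n : ℕ, ‖C ^ n‖ ≤ 1 := by
    intro n
    induction n with
    | zero => simpa [ContinuousLinearMap.one_def] using ContinuousLinearMap.norm_id_le (𝕜 := ℝ) (E := H)
    | succ n ih =>
      rw [pow_succ]
      exact (norm_mul_le _ _).trans (mul_le_one₀ ih (norm_nonneg _) hC1)
  have hle : ∀ n, ‖sqrtCoeff n • C ^ n‖ ≤ sqrtCoeff n := by
    intro n
    rw [norm_smul, Real.norm_of_nonneg (sqrtCoeff_nonneg n)]
    exact mul_le_of_le_one_right (sqrtCoeff_nonneg n) (hpow n)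
  have hsum : Summable (fun n => ‖sqrtCoeff n • C ^ n‖) :=
    Summable.of_nonneg_of_le (fun _ => norm_nonneg _) hle summable_sqrtCoeff
  set Z : H →L[ℝ] H := ∑' n, sqrtCoeff n • C ^ n with hZ
  have hZn : ‖Z‖ ≤ 1 := by
    refine (norm_tsum_le_tsum_norm hsum).trans ?_
    refine (hsum.tsum_le_tsum hle summable_sqrtCoeff).trans ?_
    exact summable_sqrtCoeff.tsum_le_of_sum_range_le sum_sqrtCoeff_le
  have hZs : IsSelfAdjoint Z := by
    rw [IsSelfAdjoint, hZ, tsum_star]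
    congr 1
    ext1 n
    rw [star_smul, star_pow, hC.star_eq]
    simp
  have hCZ : Commute C Z := by
    refine Commute.tsum_right C (fun n => ?_)
    exact ((Commute.refl C).pow_right n).smul_right _
  have hZZ : C * (Z * Z) = 2 * Z - 1 := by
    have h1 : Z * Z = ∑' n, (2 * sqrtCoeff (n + 1)) • C ^ n := by
      rw [hZ, tsum_mul_tsum_eq_tsum_sum_antidiagonal_of_summable_norm hsum hsum]
      congr 1
      ext1 n
      rw [← sum_sqrtCoeff_mul, Finset.sum_smul]
      refine Finset.sum_congr rfl (fun p hp => ?_)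
      rw [smul_mul_smul_comm, ← pow_add, Finset.HasAntidiagonal.mem_antidiagonal.1 hp]
    have h2 : Z = (1 / 2 : ℝ) • 1 + ∑' n, sqrtCoeff (n + 1) • C ^ (n + 1) := by
      rw [hZ, hsum.of_norm.tsum_eq_zero_add]
      congr 1
      simp only [sqrtCoeff, catalan_zero, pow_zero]
      norm_num
    have hs1 : Summable (fun n => sqrtCoeff (n + 1) • C ^ n) := by
      refine Summable.of_norm_bounded ((summable_nat_add_iff 1).2 summable_sqrtCoeff) (fun n => ?_)
      rw [norm_smul, Real.norm_of_nonneg (sqrtCoeff_nonneg _)]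
      exact mul_le_of_le_one_right (sqrtCoeff_nonneg _) (hpow n)
    have h3 : C * (Z * Z) = (2 : ℝ) • ∑' n, sqrtCoeff (n + 1) • C ^ (n + 1) := by
      simp_rw [h1, mul_smul]
      rw [tsum_const_smul'', mul_smul_comm, ← hs1.tsum_mul_left]
      simp_rw [mul_smul_comm, ← pow_succ']
    rw [h3, eq_sub_iff_add_eq, two_mul]
    conv_rhs => rw [h2]
    module
  refine ⟨1 - C * Z, ?_, ?_, ?_⟩
  · have : IsSelfAdjoint (C * Z) := (hC.commute_iff hZs).1 hCZ
    exact (IsSelfAdjoint.one _).sub this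
  · intro x
    have h : inner ℝ ((C * Z) x) x ≤ ‖x‖ * ‖x‖ := by
      refine (real_inner_le_norm _ _).trans ?_
      gcongr
      refine ((C * Z).le_opNorm x).trans ?_
      refine mul_le_of_le_one_left (norm_nonneg x) ?_
      exact (norm_mul_le _ _).trans (mul_le_one₀ hC1 (norm_nonneg _) hZn)
    simp only [sub_apply, one_apply_eq_self, inner_sub_left,
      real_inner_self_eq_norm_mul_norm]
    linarith
  · have h4 : C * Z * (C * Z) = 2 * (C * Z) - C := by
      calc C * Z * (C * Z) = C * (C * (Z * Z)) := by
            rw [mul_assoc, ← mul_assoc Z C Z, ← hCZ.eq, mul_assoc]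
        _ = _ := by rw [hZZ]; noncomm_ring
    calc (1 - C * Z) * (1 - C * Z) = 1 - 2 * (C * Z) + C * Z * (C * Z) := by noncomm_ring
      _ = _ := by rw [h4]; noncomm_ring

lemma exists_bounded_sqrt [CompleteSpace H] (B : H →L[ℝ] H) (hB : IsSelfAdjoint B) (c : ℝ)
    (hc : 0 < c) (hBc : ∀ x, ‖B x‖ ^ 2 ≤ c * inner ℝ (B x) x) :
    ∃ R : H →L[ℝ] H, IsSelfAdjoint R ∧ (∀ x, 0 ≤ inner ℝ (R x) x) ∧ R * R = B := by
  have hC : IsSelfAdjoint (1 - c⁻¹ • B) :=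
    (IsSelfAdjoint.one _).sub (IsSelfAdjoint.smul (IsSelfAdjoint.all c⁻¹) hB)
  have hC1 : ‖1 - c⁻¹ • B‖ ≤ 1 := by
    refine ContinuousLinearMap.opNorm_le_bound _ zero_le_one (fun x => ?_)
    rw [one_mul]
    refine (sq_le_sq₀ (norm_nonneg _) (norm_nonneg _)).1 ?_
    have h1 : (1 - c⁻¹ • B) x = x - c⁻¹ • B x := by simp
    rw [h1, norm_sub_sq_real, norm_smul, inner_smul_right, real_inner_comm, mul_pow,
      Real.norm_of_nonneg (by positivity)]
    have h2 : 0 ≤ inner ℝ (B x) x := by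
      have h := (sq_nonneg ‖B x‖).trans (hBc x)
      exact (mul_nonneg_iff_of_pos_left hc).1 h
    have h3 : c⁻¹ ^ 2 * ‖B x‖ ^ 2 ≤ c⁻¹ * inner ℝ (B x) x := by
      calc c⁻¹ ^ 2 * ‖B x‖ ^ 2 ≤ c⁻¹ ^ 2 * (c * inner ℝ (B x) x) :=
          mul_le_mul_of_nonneg_left (hBc x) (sq_nonneg _)
        _ = _ := by field_simp
    have h4 : 0 ≤ c⁻¹ * inner ℝ (B x) x := mul_nonneg (inv_nonneg.2 hc.le) h2
    linarith
  obtain ⟨R, hR, hR0, hRR⟩ := exists_sqrt_one_sub _ hC hC1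
  refine ⟨Real.sqrt c • R, IsSelfAdjoint.smul (IsSelfAdjoint.all _) hR, fun x => ?_, ?_⟩
  · simp only [smul_apply, inner_smul_left, conj_trivial]
    exact mul_nonneg (Real.sqrt_nonneg _) (hR0 x)
  · rw [smul_mul_smul_comm, Real.mul_self_sqrt hc.le, hRR, sub_sub_cancel, smul_smul,
      mul_inv_cancel₀ hc.ne', one_smul]

lemma form_eq_zero {b : V →L[ℝ] V →L[ℝ] ℝ} (hb : IsCoercive b) {v : V} (h : b v v ≤ 0) :
    v = 0 := by
  obtain ⟨C, hC, hCb⟩ := hb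
  have h1 := (hCb v).trans h
  rw [mul_assoc] at h1
  have h2 : ‖v‖ * ‖v‖ ≤ 0 := nonpos_of_mul_nonpos_right h1 hC
  have h3 := norm_nonneg v
  exact norm_eq_zero.1 (by nlinarith)

variable [CompleteSpace V] [CompleteSpace H]

lemma exists_resolvent (ι : V →L[ℝ] H) (b : V →L[ℝ] V →L[ℝ] ℝ) (hb : IsCoercive b) :
    ∃ J : H →L[ℝ] V, ∀ y v, b (J y) v = inner ℝ y (ι v) := by
  refine ⟨(hb.continuousLinearEquivOfBilin.symm : V →L[ℝ] V) ∘L ι.adjoint, fun y v => ?_⟩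
  rw [← hb.continuousLinearEquivOfBilin_apply]
  simp [ContinuousLinearMap.adjoint_inner_left]

/-- The operator associated with a bounded, symmetric, coercive form has a nonnegative self-adjoint
square root. -/
lemma exists_isNonnegSqrt {ι : V →L[ℝ] H} (hι : DenseRange ι) (hinj : Function.Injective ι)
    {b : V →L[ℝ] V →L[ℝ] ℝ} (hsymm : ∀ w v, b w v = b v w) (hb : IsCoercive b) :
    ∃ S, IsNonnegSqrt (formOperator ι b) S := by
  obtain ⟨J, hJ⟩ := exists_resolvent ι b hb
  have hBs : IsSelfAdjoint (ι ∘L J) := by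
    rw [ContinuousLinearMap.isSelfAdjoint_iff_isSymmetric]
    intro x y
    simp only [ContinuousLinearMap.coe_coe, ContinuousLinearMap.comp_apply]
    rw [← hJ x (J y), hsymm, hJ y (J x), real_inner_comm]
  have hB0 : ∀ x, ι (J x) = 0 → x = 0 := by
    intro x hx
    have h1 : J x = 0 := hinj (by simpa using hx)
    refine hι.eq_zero_of_inner_left ℝ (fun v => ?_)
    rw [← hJ, h1]; simp
  obtain ⟨R, hR, hR0, hRR⟩ : ∃ R : H →L[ℝ] H, IsSelfAdjoint R ∧ (∀ x, 0 ≤ inner ℝ (R x) x) ∧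
      R * R = ι ∘L J := by
    obtain ⟨C, hC, hCb⟩ := id hb
    refine exists_bounded_sqrt _ hBs ((‖ι‖ ^ 2 + 1) / C) (by positivity) (fun x => ?_)
    have h1 : inner ℝ ((ι ∘L J) x) x = b (J x) (J x) := by
      rw [hJ, real_inner_comm]; rfl
    rw [h1]
    have h2 := hCb (J x)
    calc ‖(ι ∘L J) x‖ ^ 2 ≤ (‖ι‖ * ‖J x‖) ^ 2 := by gcongr; exact ι.le_opNorm (J x)
      _ ≤ (‖ι‖ ^ 2 + 1) / C * (C * ‖J x‖ * ‖J x‖) := by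
        rw [div_mul_eq_mul_div, le_div_iff₀ hC]
        nlinarith [mul_nonneg hC.le (sq_nonneg ‖J x‖)]
      _ ≤ _ := by gcongr
  have hRsym : ∀ x y, inner ℝ (R x) y = inner ℝ x (R y) :=
    (ContinuousLinearMap.isSelfAdjoint_iff_isSymmetric.1 hR)
  have hRRa : ∀ x, R (R x) = ι (J x) := fun x => by
    have := DFunLike.congr_fun hRR x
    simpa using this
  have hRinj : ∀ x, R x = 0 → x = 0 := fun x hx => hB0 x (by rw [← hRRa, hx, map_zero])
  let G : Submodule ℝ (H × H) :=
    { carrier := {p | R p.2 = p.1}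
      zero_mem' := by simp
      add_mem' := by
        intro p q hp hq
        simp only [Set.mem_ofPred_eq] at *
        simp [hp, hq]
      smul_mem' := by
        intro c p hp
        simp only [Set.mem_ofPred_eq] at *
        simp [hp] }
  have hG : ∀ x y, (x, y) ∈ G ↔ R y = x := fun x y => Iff.rfl
  have hGg : G.toLinearPMap.graph = G := by
    refine Submodule.toLinearPMap_graph_eq _ ?_
    rintro ⟨x, y⟩ hxy hx
    rw [hG] at hxy
    exact hRinj y (hxy.trans hx)
  have hdom : ∀ y, R y ∈ G.toLinearPMap.domain := fun y =>
    LinearPMap.mem_domain_of_mem_graph (y := y) (by rw [hGg, hG])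
  have hdense : Dense (G.toLinearPMap.domain : Set H) := by
    rw [Submodule.dense_iff_topologicalClosure_eq_top, Submodule.topologicalClosure_eq_top_iff,
      Submodule.eq_bot_iff]
    intro x hx
    refine hRinj x (inner_self_eq_zero (𝕜 := ℝ).1 ?_)
    rw [hRsym]
    have := (Submodule.mem_orthogonal _ _).1 hx _ (hdom (R x))
    rw [real_inner_comm]
    exact this
  refine ⟨G.toLinearPMap, ?_, ?_, ?_⟩
  · rw [LinearPMap.isSelfAdjoint_def]
    apply LinearPMap.eq_of_eq_graph
    rw [LinearPMap.adjoint_graph_eq_graph_adjoint hdense, hGg]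
    ext ⟨x, y⟩
    rw [Submodule.mem_adjoint_iff, hG]
    constructor
    · intro h
      refine ext_inner_left ℝ (fun z => ?_)
      have := h (R z) z rfl
      rw [← hRsym]
      linarith
    · rintro rfl p q hpq
      rw [hG] at hpq
      simp [← hpq, hRsym]
  · intro x
    have h1 : ((x : H), G.toLinearPMap x) ∈ G := by
      have := LinearPMap.mem_graph G.toLinearPMap x
      rwa [hGg] at this
    rw [hG] at h1
    conv_rhs => rw [← h1]
    rw [real_inner_comm]
    exact hR0 _
  · intro x y
    rw [mem_formOperator_graph hι hinj, hGg]
    constructor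
    · rintro ⟨w, rfl, hw⟩
      refine ⟨R y, ?_, rfl⟩
      rw [hG, hRRa]
      congr 1
      refine sub_eq_zero.1 (form_eq_zero hb ?_)
      rw [map_sub b, sub_apply, hJ, hw, sub_self]
    · rintro ⟨z, hz, hy⟩
      rw [hG] at hz hy
      exact ⟨J y, by rw [← hz, ← hy, hRRa], hJ y⟩

lemma isNonnegSqrt_nonnegSqrt {ι : V →L[ℝ] H} (hι : DenseRange ι) (hinj : Function.Injective ι)
    {b : V →L[ℝ] V →L[ℝ] ℝ} (hsymm : ∀ w v, b w v = b v w) (hb : IsCoercive b) :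
    IsNonnegSqrt (formOperator ι b) (nonnegSqrt (formOperator ι b)) := by
  have h := exists_isNonnegSqrt hι hinj hsymm hb
  rw [nonnegSqrt, dif_pos h]
  exact h.choose_spec

/-- `V ⊆ D(A^{1/2})`. -/
lemma mem_domain_nonnegSqrt {ι : V →L[ℝ] H} (hι : DenseRange ι) (hinj : Function.Injective ι)
    {b : V →L[ℝ] V →L[ℝ] ℝ} (hsymm : ∀ w v, b w v = b v w) (hb : IsCoercive b) (v : V) :
    ι v ∈ (nonnegSqrt (formOperator ι b)).domain ∧ ‖sqrtApply ι b v‖ ^ 2 = b v v := by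
  have hS := isNonnegSqrt_nonnegSqrt hι hinj hsymm hb
  set S := nonnegSqrt (formOperator ι b) with hSdef
  obtain ⟨J, hJ⟩ := exists_resolvent ι b hb
  have hSsymm : ∀ p q p' q' : H, (p, q) ∈ S.graph → (p', q') ∈ S.graph →
      inner ℝ q p' = inner ℝ p q' := by
    intro p q p' q' h h'
    obtain ⟨a, ha, ha'⟩ := (LinearPMap.mem_graph_iff S).1 h
    obtain ⟨c, hc, hc'⟩ := (LinearPMap.mem_graph_iff S).1 h'
    have hadj := LinearPMap.adjoint_isFormalAdjoint hS.isSelfAdjoint.dense_domain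
    rw [LinearPMap.isSelfAdjoint_def.1 hS.isSelfAdjoint] at hadj
    have h3 := hadj a c
    simp only at ha ha' hc hc'
    rwa [ha', hc', ha, hc] at h3
  have hz : ∀ x, ∃ z, (ι (J x), z) ∈ S.graph ∧ (z, x) ∈ S.graph := fun x =>
    (hS.sq_eq _ _).1 ((mem_formOperator_graph hι hinj b _ _).2 ⟨J x, rfl, hJ x⟩)
  choose z hz1 hz2 using hz
  have hdiff : ∀ x y, ‖z x - z y‖ ^ 2 = b (J x - J y) (J x - J y) := by
    intro x y
    have h1 := S.graph.sub_mem (hz1 x) (hz1 y)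
    have h2 := S.graph.sub_mem (hz2 x) (hz2 y)
    have h3 := hSsymm _ _ _ _ h1 h2
    rw [← real_inner_self_eq_norm_sq, ← map_sub J, hJ]
    simp only at h3
    rw [h3, map_sub J, map_sub ι, real_inner_comm]
  have hsq : ∀ x, ‖z x‖ ^ 2 = b (J x) (J x) := by
    intro x
    have h3 := hSsymm _ _ _ _ (hz1 x) (hz2 x)
    rw [← real_inner_self_eq_norm_sq, h3, hJ, real_inner_comm]
  have hJd : DenseRange J := by
    have : Dense ((J : H →ₗ[ℝ] V).range : Set V) := by
      rw [Submodule.dense_iff_topologicalClosure_eq_top, Submodule.topologicalClosure_eq_top_iff,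
        Submodule.eq_bot_iff]
      intro p hp
      have h0 : hb.continuousLinearEquivOfBilin.symm p = 0 := by
        refine hinj ?_
        rw [map_zero]
        refine ext_inner_left ℝ (fun x => ?_)
        rw [← hJ, hsymm, ← hb.continuousLinearEquivOfBilin_apply,
          ContinuousLinearEquiv.apply_symm_apply, inner_zero_right, real_inner_comm]
        exact (Submodule.mem_orthogonal _ _).1 hp _ ⟨x, rfl⟩
      simpa using h0
    exact this
  have key : ∃ y, (ι v, y) ∈ S.graph ∧ ‖y‖ ^ 2 = b v v := by
    obtain ⟨s, hs, hsv⟩ := mem_closure_iff_seq_limit.1 (hJd v)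
    choose x hx using hs
    have hxv : Filter.Tendsto (fun n => J (x n)) Filter.atTop (nhds v) := by
      simpa [hx] using hsv
    have hcauchy : CauchySeq (fun n => z (x n)) := by
      rw [Metric.cauchySeq_iff]
      intro ε hε
      have hc := hxv.cauchySeq
      rw [Metric.cauchySeq_iff] at hc
      obtain ⟨N, hN⟩ := hc (ε / (‖b‖ + 1)) (by positivity)
      refine ⟨N, fun m hm n hn => ?_⟩
      have h1 := hN m hm n hn
      rw [dist_eq_norm] at h1 ⊢
      refine lt_of_pow_lt_pow_left₀ 2 hε.le ?_
      rw [hdiff]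
      have h2 := (le_abs_self _).trans (b.le_opNorm₂ (J (x m) - J (x n)) (J (x m) - J (x n)))
      rw [lt_div_iff₀ (by positivity)] at h1
      have h3 : (‖J (x m) - J (x n)‖ * (‖b‖ + 1)) ^ 2 < ε ^ 2 := by gcongr
      refine h2.trans_lt (lt_of_le_of_lt ?_ h3)
      nlinarith [mul_nonneg (norm_nonneg b) (sq_nonneg ‖J (x m) - J (x n)‖),
        mul_nonneg (sq_nonneg ‖b‖) (sq_nonneg ‖J (x m) - J (x n)‖),
        sq_nonneg ‖J (x m) - J (x n)‖]
    obtain ⟨y, hy⟩ := cauchySeq_tendsto_of_complete hcauchy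
    refine ⟨y, ?_, ?_⟩
    · have hcl : IsClosed (S.graph : Set (H × H)) := hS.isSelfAdjoint.isClosed
      refine hcl.mem_of_tendsto (((ι.continuous.tendsto v).comp hxv).prodMk_nhds hy) ?_
      exact Filter.Eventually.of_forall (fun n => hz1 (x n))
    · have h1 : Filter.Tendsto (fun n => ‖z (x n)‖ ^ 2) Filter.atTop (nhds (‖y‖ ^ 2)) :=
        hy.norm.pow 2
      have h2 : Filter.Tendsto (fun n => b (J (x n)) (J (x n))) Filter.atTop (nhds (b v v)) := by
        have : Continuous (fun v => b v v) := by fun_prop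
        exact (this.tendsto v).comp hxv
      simp_rw [hsq] at h1
      exact tendsto_nhds_unique h1 h2
  obtain ⟨y, hy, hyv⟩ := key
  have hdom := LinearPMap.mem_domain_of_mem_graph hy
  refine ⟨hdom, ?_⟩
  have h4 : sqrtApply ι b v = y := by
    rw [sqrtApply, dif_pos hdom]
    exact LinearPMap.mem_graph_snd_inj S (LinearPMap.mem_graph S ⟨ι v, hdom⟩) hy rfl
  rw [h4, hyv]

/-- The identity `b(w, v) = (A^{1/2} w, A^{1/2} v)_H` on `V`. -/
lemma inner_sqrtApply {ι : V →L[ℝ] H} (hι : DenseRange ι) (hinj : Function.Injective ι)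
    {b : V →L[ℝ] V →L[ℝ] ℝ} (hsymm : ∀ w v, b w v = b v w) (hb : IsCoercive b) (w v : V) :
    inner ℝ (sqrtApply ι b w) (sqrtApply ι b v) = b w v := by
  have h := mem_domain_nonnegSqrt hι hinj hsymm hb
  have hadd : sqrtApply ι b (w + v) = sqrtApply ι b w + sqrtApply ι b v := by
    rw [sqrtApply, sqrtApply, sqrtApply, dif_pos (h _).1, dif_pos (h _).1, dif_pos (h _).1,
      ← LinearPMap.map_add]
    congr 1
    ext1
    simp
  have h1 := (h (w + v)).2
  rw [hadd, norm_add_sq_real, (h w).2, (h v).2] at h1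
  simp only [map_add, add_apply] at h1
  linarith [hsymm w v]

end Form

end DualityEstimate

end

/-!
Write `A^{1/2}` for the square root of the operator of the shifted form, `y = A^{1/2} w` and `G`
for the dual convolution of `y` with `l`.

*The identity.* Tested with a fixed vector `v`, the equation says that `k * (u - u₀, v)` has the
generalized derivative `q = ⟨f, v⟩ - a(w, v)`. By the lemma of du Bois-Reymond and the vanishing
initial value, `k * (u - u₀, v) = 1 * q`; convolving with `l` and using `k * l = 1` yields
`(u - u₀, v) = l * q` (`ae_eq_conv_of_hasGeneralizedDeriv`). Since `V` is separable, one may take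
`v = w(t)` for almost every `t` (`IsWeakSolution.ae_inner_sub_self_eq`). As
`a(l * w, w) + d (l * w, w) = (l * y, y)` and the dual convolution is the adjoint of the
convolution (`integral_inner_corr`), everything reduces to the lower bound of `2 ∫ (G, y)` by the
two weighted integrals of `G`.

*The lower bound.* Let first `y` be Lipschitz with `y = 0` on `[T, ∞)`; then so is `G`. The
relation `k * l = 1` shows that the dual convolution of `G` with `k` is `∫ₜᵀ y`. Hence testing
`G(t)` with the backward difference of `k`, that is, integrating
`(k(s) - k(s - h)) (G(t), G(t + s))` over `s` and `t`, produces the integral of `(G(t), y)` over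
`(t, t + h)`, which is `h (G(t), y(t)) + O(h²)`. In the double integral the inner product is
polarized,
`2 (G(t), G(t + s)) = |G(t)|² + |G(t + s)|² - |G(t + s) - G(t)|²`.
The first two terms can be integrated in `s`, the second one along `t + s = const`; since `k` is
nonincreasing, they contribute at least `h k(T - t) |G(t)|²` and `h k(t) |G(t)|²`. In the last term
convexity of `k` gives `k(s - h) - k(s) ≥ (h / s) (k(s) - k(2s))` for `s > h`, while the part
`s ≤ h` is `O(h²)` because `G` is Lipschitz (`integral_weights_le`). Dividing by `h` and letting
`h → 0` with Fatou's lemma gives the bound (`energy_le_of_lipschitz`). A general `y` in `L²` is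
approximated by Lipschitz functions: `∫ (G, y)` is continuous by Young's inequality, and the
weighted integrals are lower semicontinuous by Fatou's lemma again (`energy_le`). Complete
monotonicity enters through the convexity of `k`.
-/

namespace DualityEstimate

open Filter Topology Set ContinuousLinearMap
open scoped Convolution ENNReal

/-! ### Young's inequality and associativity of the convolution -/

section Young

variable {E : Type*} [NormedAddCommGroup E] [NormedSpace ℝ E]

/-- The Cauchy–Schwarz inequality with respect to the weight `φ`. -/
lemma lintegral_mul_le_sqrt_mul_sqrt {φ ψ : ℝ → ℝ≥0∞} (hφ : AEMeasurable φ) (hψ : AEMeasurable ψ) :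
    (∫⁻ σ, φ σ * ψ σ) ^ 2 ≤ (∫⁻ σ, φ σ) * ∫⁻ σ, φ σ * ψ σ ^ 2 := by
  have h := ENNReal.lintegral_mul_norm_pow_le (μ := volume) hφ (hφ.mul (hψ.pow_const 2))
    (p := 1 / 2) (q := 1 / 2) (by norm_num) (by norm_num) (by norm_num)
  have h1 : ∀ σ, φ σ ^ (1 / 2 : ℝ) * ((φ * fun x => ψ x ^ 2) σ) ^ (1 / 2 : ℝ) = φ σ * ψ σ := by
    intro σ
    simp only [Pi.mul_apply]
    rw [ENNReal.mul_rpow_of_nonneg _ _ (by norm_num), ← mul_assoc,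
      ← ENNReal.rpow_add_of_nonneg _ _ (by norm_num) (by norm_num), ← ENNReal.rpow_natCast,
      ← ENNReal.rpow_mul]
    norm_num
  simp_rw [h1] at h
  calc (∫⁻ σ, φ σ * ψ σ) ^ 2
      ≤ ((∫⁻ σ, φ σ) ^ (1 / 2 : ℝ) * (∫⁻ σ, φ σ * ψ σ ^ 2) ^ (1 / 2 : ℝ)) ^ 2 := by
        gcongr
        exact h
    _ = _ := by
        rw [mul_pow, ← ENNReal.rpow_natCast, ← ENNReal.rpow_natCast, ← ENNReal.rpow_mul,
          ← ENNReal.rpow_mul]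
        norm_num

lemma eLpNorm_two_sq {F : Type*} [NormedAddCommGroup F] {f : ℝ → F} {μ : Measure ℝ} :
    eLpNorm f 2 μ ^ 2 = ∫⁻ t, ‖f t‖ₑ ^ 2 ∂μ := by
  rw [eLpNorm_eq_lintegral_rpow_enorm_toReal (by norm_num) (by norm_num), ← ENNReal.rpow_natCast,
    ← ENNReal.rpow_mul]
  norm_num

/-- Young's inequality `L¹ * L² ⊆ L²`. -/
lemma eLpNorm_convolution_le {L : ℝ → ℝ} {f : ℝ → E} (hL : AEStronglyMeasurable L)
    (hf : AEStronglyMeasurable f) :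
    eLpNorm (L ⋆[lsmul ℝ ℝ, volume] f) 2 volume ≤ eLpNorm L 1 volume * eLpNorm f 2 volume := by
  have hpw : ∀ t, ‖(L ⋆[lsmul ℝ ℝ, volume] f) t‖ₑ ^ 2 ≤
      (∫⁻ σ, ‖L σ‖ₑ) * ∫⁻ σ, ‖L σ‖ₑ * ‖f (t - σ)‖ₑ ^ 2 := by
    intro t
    refine le_trans ?_ (lintegral_mul_le_sqrt_mul_sqrt hL.enorm ?_)
    · gcongr
      rw [convolution_def]
      refine (enorm_integral_le_lintegral_enorm _).trans (le_of_eq ?_)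
      simp [enorm_smul]
    · exact (hf.comp_quasiMeasurePreserving
        (quasiMeasurePreserving_sub_left_of_right_invariant volume t)).enorm
  have hm : AEMeasurable (fun p : ℝ × ℝ => ‖L p.2‖ₑ * ‖f (p.1 - p.2)‖ₑ ^ 2)
      (volume.prod volume) := by
    refine (hL.comp_snd).enorm.mul (AEMeasurable.pow_const ?_ 2)
    exact (hf.comp_quasiMeasurePreserving
      (quasiMeasurePreserving_sub_of_right_invariant volume volume)).enorm
  refine (ENNReal.pow_le_pow_left_iff two_ne_zero).1 ?_
  rw [mul_pow, eLpNorm_two_sq, eLpNorm_two_sq, eLpNorm_one_eq_lintegral_enorm]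
  calc ∫⁻ t, ‖(L ⋆[lsmul ℝ ℝ, volume] f) t‖ₑ ^ 2
      ≤ ∫⁻ t, (∫⁻ σ, ‖L σ‖ₑ) * ∫⁻ σ, ‖L σ‖ₑ * ‖f (t - σ)‖ₑ ^ 2 := lintegral_mono hpw
    _ = (∫⁻ σ, ‖L σ‖ₑ) * ∫⁻ t, ∫⁻ σ, ‖L σ‖ₑ * ‖f (t - σ)‖ₑ ^ 2 := by
        rw [lintegral_const_mul'' _ hm.lintegral_prod_right']
    _ = (∫⁻ σ, ‖L σ‖ₑ) * ∫⁻ σ, ∫⁻ t, ‖L σ‖ₑ * ‖f (t - σ)‖ₑ ^ 2 := by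
        rw [lintegral_lintegral_swap hm]
    _ = (∫⁻ σ, ‖L σ‖ₑ) * ∫⁻ σ, ‖L σ‖ₑ * ∫⁻ t, ‖f t‖ₑ ^ 2 := by
        congr 2
        ext σ
        rw [lintegral_const_mul' _ _ enorm_ne_top,
          lintegral_sub_right_eq_self (fun t => ‖f t‖ₑ ^ 2) σ]
    _ = _ := by
        rw [lintegral_mul_const'' _ hL.enorm]
        ring

lemma aestronglyMeasurable_convolution {L : ℝ → ℝ} {f : ℝ → E} (hL : AEStronglyMeasurable L)
    (hf : AEStronglyMeasurable f) :
    AEStronglyMeasurable (L ⋆[lsmul ℝ ℝ, volume] f) :=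
  (hL.convolution_integrand (lsmul ℝ ℝ) hf).integral_prod_right'

lemma memLp_convolution {L : ℝ → ℝ} {f : ℝ → E} (hL : Integrable L)
    (hf : MemLp f 2) : MemLp (L ⋆[lsmul ℝ ℝ, volume] f) 2 :=
  ⟨aestronglyMeasurable_convolution hL.aestronglyMeasurable hf.aestronglyMeasurable,
    (eLpNorm_convolution_le hL.aestronglyMeasurable hf.aestronglyMeasurable).trans_lt
      (ENNReal.mul_lt_top (memLp_one_iff_integrable.2 hL).eLpNorm_lt_top hf.eLpNorm_lt_top)⟩

/-- Associativity of the convolution of integrable functions, almost everywhere. -/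
lemma convolution_assoc_ae [CompleteSpace E] {K L : ℝ → ℝ} {f : ℝ → E} (hK : Integrable K)
    (hL : Integrable L) (hf : Integrable f) :
    ∀ᵐ t, ((K ⋆[lsmul ℝ ℝ, volume] L) ⋆[lsmul ℝ ℝ, volume] f) t =
      (K ⋆[lsmul ℝ ℝ, volume] (L ⋆[lsmul ℝ ℝ, volume] f)) t := by
  have hLf : Integrable ((fun x => ‖L x‖) ⋆[mul ℝ ℝ, volume] fun x => ‖f x‖) :=
    hL.norm.integrable_convolution (mul ℝ ℝ) hf.norm
  filter_upwards [hK.norm.ae_convolution_exists (mul ℝ ℝ) hLf] with t ht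
  refine convolution_assoc (lsmul ℝ ℝ) (lsmul ℝ ℝ) (lsmul ℝ ℝ) (lsmul ℝ ℝ) ?_
    hK.aestronglyMeasurable hL.aestronglyMeasurable hf.aestronglyMeasurable
    (hK.ae_convolution_exists _ hL) (hL.norm.ae_convolution_exists _ hf.norm) ht
  exact fun x y z => smul_assoc x y z

/-- Associativity of the convolution at every point, with a bounded continuous last factor. -/
lemma convolution_assoc_of_bounded [CompleteSpace E] {K L : ℝ → ℝ} {f : ℝ → E}
    (hK : Integrable K) (hL : Integrable L) (hf : Continuous f) {B : ℝ} (hB : ∀ t, ‖f t‖ ≤ B)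
    (t : ℝ) :
    ((K ⋆[lsmul ℝ ℝ, volume] L) ⋆[lsmul ℝ ℝ, volume] f) t =
      (K ⋆[lsmul ℝ ℝ, volume] (L ⋆[lsmul ℝ ℝ, volume] f)) t := by
  have hex : ∀ x, ConvolutionExistsAt (fun x => ‖L x‖) (fun x => ‖f x‖) x (mul ℝ ℝ) volume := by
    intro x
    refine (hL.norm.mul_const B).mono' (by
      refine AEStronglyMeasurable.convolution_integrand_snd (mul ℝ ℝ) hL.norm.aestronglyMeasurable
        hf.norm.aestronglyMeasurable x) (.of_forall fun s => ?_)
    simp only [mul_apply', norm_mul, norm_norm]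
    gcongr
    exact hB _
  refine convolution_assoc (lsmul ℝ ℝ) (lsmul ℝ ℝ) (lsmul ℝ ℝ) (lsmul ℝ ℝ) ?_
    hK.aestronglyMeasurable hL.aestronglyMeasurable hf.aestronglyMeasurable
    (hK.ae_convolution_exists _ hL) (.of_forall hex) ?_
  · exact fun x y z => smul_assoc x y z
  · have hm : AEStronglyMeasurable ((fun x => ‖L x‖) ⋆[mul ℝ ℝ, volume] fun x => ‖f x‖) :=
      (hL.norm.aestronglyMeasurable.convolution_integrand (mul ℝ ℝ)
        hf.norm.aestronglyMeasurable).integral_prod_right'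
    refine (hK.norm.mul_const ((∫ s, ‖L s‖) * B)).mono'
      (hK.norm.aestronglyMeasurable.convolution_integrand_snd (mul ℝ ℝ) hm t)
      (.of_forall fun s => ?_)
    simp only [mul_apply', norm_mul, norm_norm]
    gcongr
    rw [convolution_def, ← integral_mul_const]
    refine norm_integral_le_of_norm_le (hL.norm.mul_const B) (.of_forall fun r => ?_)
    simp only [mul_apply', norm_mul, norm_norm]
    gcongr
    exact hB _

end Young

/-! ### Truncation to the interval and the dual convolution as a correlation -/

section Trunc

variable {E : Type*} [NormedAddCommGroup E]

/-- The extension by zero of the restriction of `g` to `(0, T)`. -/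
noncomputable def trunc (T : ℝ) (g : ℝ → E) : ℝ → E := (Ioo 0 T).indicator g

lemma trunc_of_mem {T : ℝ} (g : ℝ → E) {t : ℝ} (ht : t ∈ Ioo 0 T) : trunc T g t = g t :=
  indicator_of_mem ht g

lemma trunc_of_notMem {T : ℝ} (g : ℝ → E) {t : ℝ} (ht : t ∉ Ioo 0 T) : trunc T g t = 0 :=
  indicator_of_notMem ht g

lemma memLp_trunc {T : ℝ} {g : ℝ → E} {p : ℝ≥0∞} (hg : MemLp g p (volume.restrict (Ioo 0 T))) :
    MemLp (trunc T g) p := (memLp_indicator_iff_restrict measurableSet_Ioo).2 hg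

lemma integrable_trunc {T : ℝ} {g : ℝ → E} (hg : IntegrableOn g (Ioo 0 T)) :
    Integrable (trunc T g) := (integrable_indicator_iff measurableSet_Ioo).2 hg

lemma integrable_trunc_of_memLp {T : ℝ} {g : ℝ → E} (hg : MemLp g 2 (volume.restrict (Ioo 0 T))) :
    Integrable (trunc T g) :=
  integrable_trunc (hg.integrable (by norm_num))

variable [NormedSpace ℝ E]

lemma integrable_trunc_of_locallyIntegrableOn {k : ℝ → ℝ} (hk : LocallyIntegrableOn k (Ici 0))
    (T : ℝ) : Integrable (trunc T k) :=
  integrable_trunc ((hk.integrableOn_compact_subset Icc_subset_Ici_self isCompact_Icc).mono_set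
    Ioo_subset_Icc_self)

/-- On `(0, T)` the half-line convolution only sees the values of both factors on `(0, T)`; this
holds for the integrands already. -/
lemma conv_integrand_eq {T : ℝ} (k : ℝ → ℝ) (g : ℝ → E) {t : ℝ} (ht : t ∈ Ioo 0 T) (τ : ℝ) :
    (Ioo 0 t).indicator (fun τ => k (t - τ) • g τ) τ = trunc T k (t - τ) • trunc T g τ := by
  by_cases hτ : τ ∈ Ioo 0 t
  · rw [indicator_of_mem hτ, trunc_of_mem, trunc_of_mem]
    · exact ⟨hτ.1, hτ.2.trans ht.2⟩
    · exact ⟨by linarith [hτ.2], by linarith [hτ.1, ht.2]⟩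
  · rw [indicator_of_notMem hτ]
    by_cases h1 : τ ∈ Ioo 0 T
    · have : t - τ ∉ Ioo 0 T := fun h => hτ ⟨h1.1, by linarith [h.1]⟩
      rw [trunc_of_notMem _ this, zero_smul]
    · rw [trunc_of_notMem _ h1, smul_zero]

lemma conv_eq_convolution {T : ℝ} (k : ℝ → ℝ) (g : ℝ → E) {t : ℝ} (ht : t ∈ Ioo 0 T) :
    conv k g t = (trunc T k ⋆[lsmul ℝ ℝ, volume] trunc T g) t := by
  rw [conv, intervalIntegral.integral_of_le ht.1.le, integral_Ioc_eq_integral_Ioo,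
    ← integral_indicator measurableSet_Ioo, convolution_lsmul_swap]
  exact integral_congr_ae (.of_forall (conv_integrand_eq k g ht))

/-- The correlation `∫ L(σ) y(t + σ) dσ`, which is the dual convolution on the whole line. -/
noncomputable def corr (L : ℝ → ℝ) (y : ℝ → E) (t : ℝ) : E := ∫ σ, L σ • y (t + σ)

lemma corr_eq_convolution (L : ℝ → ℝ) (y : ℝ → E) (t : ℝ) :
    corr L y t = (L ⋆[lsmul ℝ ℝ, volume] fun x => y (-x)) (-t) := by
  simp [corr, convolution_def, add_comm]

lemma dualConv_eq_corr {T : ℝ} (l : ℝ → ℝ) (g : ℝ → E) {t : ℝ} (ht : t ∈ Ioo 0 T) :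
    dualConv T l g t = corr (trunc T l) (trunc T g) t := by
  have h : corr (trunc T l) (trunc T g) t = ∫ τ, trunc T l (τ - t) • trunc T g τ := by
    rw [corr, ← integral_sub_right_eq_self _ t]
    simp
  rw [h, dualConv, intervalIntegral.integral_of_le ht.2.le, integral_Ioc_eq_integral_Ioo,
    ← integral_indicator measurableSet_Ioo]
  refine integral_congr_ae (.of_forall fun τ => ?_)
  by_cases hτ : τ ∈ Ioo t T
  · simp only [indicator_of_mem hτ]
    rw [trunc_of_mem, trunc_of_mem]
    · exact ⟨ht.1.trans hτ.1, hτ.2⟩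
    · exact ⟨by linarith [hτ.1], by linarith [hτ.2, ht.1]⟩
  · simp only [indicator_of_notMem hτ]
    by_cases h1 : τ ∈ Ioo 0 T
    · have : τ - t ∉ Ioo 0 T := fun h => hτ ⟨by linarith [h.1], h1.2⟩
      rw [trunc_of_notMem _ this, zero_smul]
    · rw [trunc_of_notMem _ h1, smul_zero]

lemma aestronglyMeasurable_corr {L : ℝ → ℝ} {y : ℝ → E} (hL : AEStronglyMeasurable L)
    (hy : AEStronglyMeasurable y) : AEStronglyMeasurable (corr L y) := by
  have h := aestronglyMeasurable_convolution hL
    (hy.comp_quasiMeasurePreserving (Measure.measurePreserving_neg volume).quasiMeasurePreserving)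
  have h' := h.comp_quasiMeasurePreserving
    (Measure.measurePreserving_neg volume).quasiMeasurePreserving
  refine h'.congr (.of_forall fun t => ?_)
  rw [corr_eq_convolution]
  rfl

lemma eLpNorm_corr_le {L : ℝ → ℝ} {y : ℝ → E} (hL : AEStronglyMeasurable L)
    (hy : AEStronglyMeasurable y) :
    eLpNorm (corr L y) 2 volume ≤ eLpNorm L 1 volume * eLpNorm y 2 volume := by
  have hneg := Measure.measurePreserving_neg (volume : Measure ℝ)
  have hy' := hy.comp_quasiMeasurePreserving hneg.quasiMeasurePreserving
  have h := eLpNorm_convolution_le hL hy'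
  have h1 : corr L y = (L ⋆[lsmul ℝ ℝ, volume] (y ∘ Neg.neg)) ∘ Neg.neg := by
    ext t
    rw [corr_eq_convolution]
    rfl
  rw [h1, eLpNorm_comp_measurePreserving (aestronglyMeasurable_convolution hL hy') hneg]
  rwa [eLpNorm_comp_measurePreserving hy hneg] at h

lemma memLp_corr {L : ℝ → ℝ} {y : ℝ → E} (hL : Integrable L) (hy : MemLp y 2) :
    MemLp (corr L y) 2 :=
  ⟨aestronglyMeasurable_corr hL.aestronglyMeasurable hy.aestronglyMeasurable,
    (eLpNorm_corr_le hL.aestronglyMeasurable hy.aestronglyMeasurable).trans_lt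
      (ENNReal.mul_lt_top (memLp_one_iff_integrable.2 hL).eLpNorm_lt_top hy.eLpNorm_lt_top)⟩

lemma ae_integrable_corr {L : ℝ → ℝ} {y : ℝ → E} (hL : Integrable L) (hy : Integrable y) :
    ∀ᵐ t, Integrable (fun σ => L σ • y (t + σ)) := by
  have h := hL.ae_convolution_exists (lsmul ℝ ℝ) hy.comp_neg
  have h' := (Measure.measurePreserving_neg (volume : Measure ℝ)).quasiMeasurePreserving.ae h
  filter_upwards [h'] with t ht
  have := ht.integrable
  simpa [add_comm] using this

end Trunc

/-! ### Convolution of functions supported on the half-line -/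

section Causal

variable {E : Type*} [NormedAddCommGroup E] [NormedSpace ℝ E]

/-- Causality: the convolution with a function supported on the half-line depends, up to time
`T`, only on the values of the kernel before `T`. -/
lemma convolution_congr_left {T : ℝ} {M M' : ℝ → ℝ} {f : ℝ → E}
    (hM : ∀ᵐ s, s < T → M s = M' s) (hf : ∀ s ≤ 0, f s = 0) {t : ℝ} (ht : t ≤ T) :
    (M ⋆[lsmul ℝ ℝ, volume] f) t = (M' ⋆[lsmul ℝ ℝ, volume] f) t := by
  rw [convolution_lsmul, convolution_lsmul]
  refine integral_congr_ae ?_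
  filter_upwards [hM] with s hs
  by_cases h : s < t
  · rw [hs (h.trans_le ht)]
  · rw [hf _ (by linarith), smul_zero, smul_zero]

lemma convolution_congr_right {T : ℝ} {M : ℝ → ℝ} {f f' : ℝ → E}
    (hf : ∀ᵐ s, s < T → f s = f' s) (hM : ∀ s ≤ 0, M s = 0) {t : ℝ} (ht : t ≤ T) :
    (M ⋆[lsmul ℝ ℝ, volume] f) t = (M ⋆[lsmul ℝ ℝ, volume] f') t := by
  rw [convolution_lsmul_swap, convolution_lsmul_swap]
  refine integral_congr_ae ?_
  filter_upwards [hf] with s hs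
  by_cases h : s < t
  · rw [hs (h.trans_le ht)]
  · rw [hM _ (by linarith), zero_smul, zero_smul]

lemma convolution_eq_zero {M : ℝ → ℝ} {f : ℝ → E} (hM : ∀ s ≤ 0, M s = 0)
    (hf : ∀ s ≤ 0, f s = 0) {t : ℝ} (ht : t ≤ 0) : (M ⋆[lsmul ℝ ℝ, volume] f) t = 0 := by
  rw [convolution_lsmul]
  refine integral_eq_zero_of_ae (.of_forall fun s => ?_)
  rcases le_or_gt s 0 with h | h
  · simp [hM s h]
  · simp [hf (t - s) (by linarith)]

lemma trunc_eq_zero_of_nonpos {F : Type*} [NormedAddCommGroup F] {T : ℝ} (g : ℝ → F) {s : ℝ}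
    (hs : s ≤ 0) : trunc T g s = 0 :=
  trunc_of_notMem _ fun h => absurd h.1 (not_lt.2 hs)

lemma convolution_one {T : ℝ} {f : ℝ → E} (hf : ∀ s ≤ 0, f s = 0) {t : ℝ} (ht : t ∈ Ioo 0 T) :
    (trunc T (fun _ => (1 : ℝ)) ⋆[lsmul ℝ ℝ, volume] f) t = ∫ s in (0 : ℝ)..t, f s := by
  rw [intervalIntegral.integral_of_le ht.1.le, integral_Ioc_eq_integral_Ioo,
    ← integral_indicator measurableSet_Ioo, convolution_lsmul_swap]
  refine integral_congr_ae (.of_forall fun s => ?_)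
  by_cases hs : s ∈ Ioo 0 t
  · simp only [indicator_of_mem hs]
    rw [trunc_of_mem, one_smul]
    exact ⟨by linarith [hs.2], by linarith [hs.1, ht.2]⟩
  · simp only [indicator_of_notMem hs]
    rcases le_or_gt s 0 with h | h
    · rw [hf s h, smul_zero]
    · rw [trunc_eq_zero_of_nonpos, zero_smul]
      by_contra! h'
      exact hs ⟨h, by linarith⟩

lemma convolution_comm_real (K L : ℝ → ℝ) :
    (K ⋆[lsmul ℝ ℝ, volume] L) = (L ⋆[lsmul ℝ ℝ, volume] K) := by
  ext t
  rw [convolution_lsmul, convolution_lsmul_swap]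
  simp [mul_comm]

/-- The identity `k * l = 1` for the truncated kernels; beyond `T` it may fail because of the
truncation. -/
lemma IsPCPair.convolution_trunc {k l : ℝ → ℝ} (hkl : IsPCPair k l) (T : ℝ) :
    ∀ᵐ s, s < T → (trunc T k ⋆[lsmul ℝ ℝ, volume] trunc T l) s = trunc T (fun _ => (1 : ℝ)) s := by
  filter_upwards [hkl.conv_eq_one] with s hs hsT
  rcases le_or_gt s 0 with h | h
  · rw [trunc_eq_zero_of_nonpos _ h]
    exact convolution_eq_zero (fun _ => trunc_eq_zero_of_nonpos _)
      (fun _ => trunc_eq_zero_of_nonpos _) h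
  · rw [trunc_of_mem _ ⟨h, hsT⟩, ← conv_eq_convolution k l ⟨h, hsT⟩, hs h]

lemma integral_trunc {T : ℝ} (f : ℝ → E) {t : ℝ} (ht : t ∈ Icc 0 T) :
    ∫ s in (0 : ℝ)..t, trunc T f s = ∫ s in (0 : ℝ)..t, f s := by
  rw [intervalIntegral.integral_of_le ht.1, intervalIntegral.integral_of_le ht.1,
    integral_Ioc_eq_integral_Ioo, integral_Ioc_eq_integral_Ioo]
  exact setIntegral_congr_fun measurableSet_Ioo fun s hs =>
    trunc_of_mem f ⟨hs.1, hs.2.trans_le ht.2⟩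

end Causal

/-! ### The lemma of du Bois-Reymond -/

section DuBoisReymond

/-- Integration by parts against a test function. -/
lemma integral_primitive_mul_deriv {T : ℝ} {q φ : ℝ → ℝ} (hq : Integrable q)
    (hφ : ContDiff ℝ ∞ φ) (hsupp : tsupport φ ⊆ Ioo 0 T) :
    ∫ t in (0 : ℝ)..T, (∫ s in (0 : ℝ)..t, q s) * deriv φ t = - ∫ t in (0 : ℝ)..T, q t * φ t := by
  have hqi : IntervalIntegrable q volume 0 T := hq.intervalIntegrable
  have hac := hqi.absolutelyContinuousOnInterval_intervalIntegral (c := 0) (by simp)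
  have hac' : AbsolutelyContinuousOnInterval φ 0 T :=
    ContDiffOn.absolutelyContinuousOnInterval ((hφ.of_le (by simp)).contDiffOn)
  have h0 : φ 0 = 0 := image_eq_zero_of_notMem_tsupport fun h => by simpa using hsupp h
  have h1 : φ T = 0 := image_eq_zero_of_notMem_tsupport fun h => by simpa using hsupp h
  rw [hac.integral_mul_deriv_eq_deriv_mul hac', h0, h1, mul_zero, mul_zero, sub_zero, zero_sub]
  congr 1
  refine intervalIntegral.integral_congr_ae ?_
  filter_upwards [hqi.ae_hasDerivAt_integral] with t ht htT
  have := ht (uIoc_subset_uIcc htT) 0 (by simp)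
  rw [this.deriv]

/-- The lemma of du Bois-Reymond on `(0, T)`. -/
lemma exists_ae_eq_const_of_integral_deriv_eq_zero {T : ℝ} (hT : 0 < T) {W : ℝ → ℝ}
    (hW : IntegrableOn W (Ioo 0 T))
    (h : ∀ φ : ℝ → ℝ, ContDiff ℝ ∞ φ → HasCompactSupport φ → tsupport φ ⊆ Ioo 0 T →
      ∫ t in (0 : ℝ)..T, W t * deriv φ t = 0) :
    ∃ c, ∀ᵐ t, t ∈ Ioo 0 T → W t = c := by
  let bump : ContDiffBump (T / 2) := ⟨T / 8, T / 4, by positivity, by linarith⟩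
  set ρ : ℝ → ℝ := bump.normed volume with hρ
  have hρc : ContDiff ℝ ∞ ρ := bump.contDiff_normed
  have hρs : tsupport ρ = Metric.closedBall (T / 2) (T / 4) := bump.tsupport_normed_eq
  have hρT : tsupport ρ ⊆ Ioo 0 T := by
    rw [hρs, Real.closedBall_eq_Icc]
    intro x hx
    exact ⟨by linarith [hx.1], by linarith [hx.2]⟩
  have hρk : HasCompactSupport ρ := by
    rw [HasCompactSupport, hρs]
    exact isCompact_closedBall _ _
  have hρ1 : ∫ t, ρ t = 1 := bump.integral_normed
  have hint : ∀ ψ : ℝ → ℝ, Continuous ψ → HasCompactSupport ψ →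
      IntervalIntegrable (fun t => W t * ψ t) volume 0 T := by
    intro ψ hψ hψk
    have hWi : IntervalIntegrable W volume 0 T := by
      rw [intervalIntegrable_iff_integrableOn_Ioo_of_le hT.le]
      exact hW
    exact hWi.mul_continuousOn hψ.continuousOn
  refine ⟨∫ t in (0 : ℝ)..T, W t * ρ t, ?_⟩
  set c := ∫ t in (0 : ℝ)..T, W t * ρ t with hc
  have hkey : ∀ ψ : ℝ → ℝ, ContDiff ℝ ∞ ψ → HasCompactSupport ψ → tsupport ψ ⊆ Ioo 0 T →
      ∫ t, ψ t • (W t - c) = 0 := by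
    intro ψ hψ hψk hψT
    set m := ∫ t, ψ t with hm
    -- `η` has mean zero, so that its primitive is again a test function
    set η : ℝ → ℝ := fun t => ψ t - m * ρ t with hη
    have hηc : ContDiff ℝ ∞ η := hψ.sub (contDiff_const.mul hρc)
    have hη0 : ∫ t, η t = 0 := by
      rw [hη, integral_sub (hψ.continuous.integrable_of_hasCompactSupport hψk)
        ((hρc.continuous.integrable_of_hasCompactSupport hρk).const_mul m), integral_const_mul, hρ1]
      simp [hm]
    -- a compact interval inside `(0, T)` that carries both test functions
    obtain ⟨a, b, ha, hb, hab⟩ : ∃ a b, 0 < a ∧ b < T ∧ ∀ t, t ∉ Icc a b → η t = 0 := by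
      have hS : IsCompact (tsupport ψ ∪ tsupport ρ) := hψk.isCompact.union hρk.isCompact
      have hne : (tsupport ψ ∪ tsupport ρ).Nonempty := by
        refine ⟨T / 2, Or.inr ?_⟩
        rw [hρs]
        exact Metric.mem_closedBall_self (by positivity)
      have hsub := union_subset hψT hρT
      refine ⟨sInf (tsupport ψ ∪ tsupport ρ), sSup (tsupport ψ ∪ tsupport ρ),
        (hsub (hS.sInf_mem hne)).1, (hsub (hS.sSup_mem hne)).2, fun t ht => ?_⟩
      have ht' : t ∉ tsupport ψ ∪ tsupport ρ := fun h' =>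
        ht ⟨csInf_le hS.bddBelow h', le_csSup hS.bddAbove h'⟩
      rw [mem_union, not_or] at ht'
      simp [hη, image_eq_zero_of_notMem_tsupport ht'.1, image_eq_zero_of_notMem_tsupport ht'.2]
    set φ : ℝ → ℝ := fun t => ∫ s in (0 : ℝ)..t, η s with hφ
    have hder : ∀ t, HasDerivAt φ (η t) t := fun t =>
      intervalIntegral.integral_hasDerivAt_right (hηc.continuous.intervalIntegrable _ _)
        (hηc.continuous.stronglyMeasurableAtFilter _ _) hηc.continuous.continuousAt
    have hderiv : deriv φ = η := funext fun t => (hder t).deriv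
    have hφc : ContDiff ℝ ∞ φ := by
      rw [contDiff_infty_iff_deriv]
      exact ⟨fun t => (hder t).differentiableAt, by rwa [hderiv]⟩
    have hφ0 : ∀ t, t ∉ Icc a b → φ t = 0 := by
      intro t ht
      rcases lt_or_ge t a with h1 | h1
      · rw [hφ]
        refine intervalIntegral.integral_zero_ae (.of_forall fun s hs => hab s fun h' => ?_)
        have := hs.2
        have h2 := h'.1
        rcases le_total 0 t with h3 | h3
        · rw [max_eq_right h3] at this; linarith
        · rw [max_eq_left h3] at this; linarith
      · have h2 : b < t := by
          by_contra! h2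
          exact ht ⟨h1, h2⟩
        rw [hφ]
        simp only
        rw [intervalIntegral.integral_eq_integral_of_support_subset, hη0]
        intro s hs
        have h3 : s ∈ Icc a b := by
          by_contra h3
          exact hs (hab s h3)
        exact ⟨ha.trans_le h3.1, h3.2.trans h2.le⟩
    have hφs : tsupport φ ⊆ Icc a b := by
      refine closure_minimal (fun t ht => ?_) isClosed_Icc
      by_contra h'
      exact ht (hφ0 t h')
    have hφk : HasCompactSupport φ := isCompact_Icc.of_isClosed_subset (isClosed_tsupport φ) hφs
    have h1 := h φ hφc hφk (hφs.trans fun x hx => ⟨ha.trans_le hx.1, hx.2.trans_lt hb⟩)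
    rw [hderiv] at h1
    have h2 : ∫ t in (0 : ℝ)..T, W t * η t = (∫ t in (0 : ℝ)..T, W t * ψ t) - m * c := by
      rw [hc, ← intervalIntegral.integral_const_mul, ← intervalIntegral.integral_sub
        (hint ψ hψ.continuous hψk) ((hint ρ hρc.continuous hρk).const_mul m)]
      congr 1
      ext t
      simp only [hη]
      ring
    have hψs : ∀ g : ℝ → ℝ, Function.support (fun t => g t * ψ t) ⊆ Ioc 0 T := fun g t ht => by
      have h3 : ψ t ≠ 0 := fun h' => ht (by simp [h'])
      exact Ioo_subset_Ioc_self (hψT (subset_tsupport _ h3))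
    have h3 : ∫ t, ψ t • (W t - c) = ∫ t in (0 : ℝ)..T, (W t - c) * ψ t := by
      rw [intervalIntegral.integral_eq_integral_of_support_subset (hψs _)]
      simp [mul_comm]
    have h4 : m = ∫ t in (0 : ℝ)..T, ψ t := by
      rw [hm, intervalIntegral.integral_eq_integral_of_support_subset]
      simpa using hψs fun _ => 1
    rw [h3]
    simp_rw [sub_mul]
    rw [intervalIntegral.integral_sub (hint ψ hψ.continuous hψk)
      ((hψ.continuous.intervalIntegrable 0 T).const_mul c), intervalIntegral.integral_const_mul,
      ← h4]
    linarith
  have hloc : LocallyIntegrableOn (fun t => W t - c) (Ioo 0 T) :=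
    (hW.sub (integrableOn_const (by simp))).locallyIntegrableOn
  filter_upwards [isOpen_Ioo.ae_eq_zero_of_integral_contDiff_smul_eq_zero hloc hkey] with t ht htT
  linarith [ht htT]

end DuBoisReymond

/-! ### Inverting the equation with the kernel `l` -/

section Representation

/-- An integrable function whose primitive vanishes almost everywhere vanishes almost everywhere. -/
lemma ae_eq_zero_of_ae_primitive_eq_zero {T : ℝ} {z : ℝ → ℝ} (hz : Integrable z)
    (h : ∀ᵐ t, t ∈ Ioo 0 T → ∫ s in (0 : ℝ)..t, z s = 0) : ∀ᵐ t, t ∈ Ioo 0 T → z t = 0 := by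
  have hcont : Continuous fun t => ∫ s in (0 : ℝ)..t, z s :=
    intervalIntegral.continuous_primitive (fun _ _ => hz.intervalIntegrable) 0
  have hall : ∀ t ∈ Ioo 0 T, ∫ s in (0 : ℝ)..t, z s = 0 := by
    refine Measure.eqOn_open_of_ae_eq (μ := volume) (f := fun t => ∫ s in (0 : ℝ)..t, z s)
      (g := fun _ => 0) ?_ isOpen_Ioo hcont.continuousOn continuousOn_const
    exact (ae_restrict_iff' measurableSet_Ioo).2 h
  filter_upwards [LocallyIntegrable.ae_hasDerivAt_integral hz.locallyIntegrable] with t ht htT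
  have h1 : HasDerivAt (fun _ : ℝ => (0 : ℝ)) (z t) t := by
    refine (ht 0).congr_of_eventuallyEq ?_
    filter_upwards [isOpen_Ioo.mem_nhds htT] with x hx
    exact (hall x hx).symm
  exact h1.unique (hasDerivAt_const t 0)

/-- If `k * p` has the generalized derivative `q` and vanishes at `0`, then `p = l * q`: indeed
`k * p = 1 * q`, and convolving with `l` gives `1 * p = 1 * (l * q)`. The function `F` is a
representative of `k * p` with generalized derivative `g`, and `c` is its continuous one. -/
lemma ae_eq_conv_of_hasGeneralizedDeriv {k l : ℝ → ℝ} (hkl : IsPCPair k l) {T : ℝ} (hT : 0 < T)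
    {p q F g c : ℝ → ℝ} (hp : IntegrableOn p (Ioo 0 T)) (hq : IntegrableOn q (Ioo 0 T))
    (hFp : ∀ᵐ t, t ∈ Ioo 0 T → F t = conv k p t) (hF : HasGeneralizedDeriv T F g)
    (hgq : ∀ᵐ t, t ∈ Ioo 0 T → g t = q t) (hc : ContinuousOn c (Icc 0 T)) (hc0 : c 0 = 0)
    (hFc : ∀ᵐ t, t ∈ Ioo 0 T → F t = c t) :
    ∀ᵐ t, t ∈ Ioo 0 T → p t = conv l q t := by
  have hK := integrable_trunc_of_locallyIntegrableOn hkl.locallyIntegrable_left T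
  have hL := integrable_trunc_of_locallyIntegrableOn hkl.locallyIntegrable_right T
  have hp' := integrable_trunc hp
  have hq' := integrable_trunc hq
  have h1' : Integrable (trunc T fun _ => (1 : ℝ)) :=
    integrable_trunc (integrableOn_const (by simp))
  have hKp := hK.integrable_convolution (lsmul ℝ ℝ) hp'
  have hLq := hL.integrable_convolution (lsmul ℝ ℝ) hq'
  set Q : ℝ → ℝ := fun t => ∫ s in (0 : ℝ)..t, trunc T q s with hQ
  have hQc : Continuous Q :=
    intervalIntegral.continuous_primitive (fun _ _ => hq'.intervalIntegrable) 0
  have hFK : ∀ᵐ t, t ∈ Ioo 0 T → F t = (trunc T k ⋆[lsmul ℝ ℝ, volume] trunc T p) t := by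
    filter_upwards [hFp] with t ht htT
    rw [ht htT, conv_eq_convolution k p htT]
  have hFint : IntegrableOn F (Ioo 0 T) :=
    hKp.integrableOn.congr ((ae_restrict_iff' measurableSet_Ioo).2
      (hFK.mono fun t ht htT => (ht htT).symm))
  -- `F` and the primitive of `q` differ by a constant, which vanishes by continuity at `0`
  obtain ⟨C, hC⟩ : ∃ C, ∀ᵐ t, t ∈ Ioo 0 T → F t - Q t = C := by
    refine exists_ae_eq_const_of_integral_deriv_eq_zero hT
      (hFint.sub (hQc.integrableOn_Icc.mono_set Ioo_subset_Icc_self)) fun φ hφ hφk hφT => ?_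
    have hφd : Continuous (deriv φ) := hφ.continuous_deriv (by simp)
    have hFi : IntervalIntegrable F volume 0 T := by
      rw [intervalIntegrable_iff_integrableOn_Ioo_of_le hT.le]
      exact hFint
    simp_rw [sub_mul]
    rw [intervalIntegral.integral_sub (hFi.mul_continuousOn hφd.continuousOn)
      ((by fun_prop : Continuous fun t => Q t * deriv φ t).intervalIntegrable 0 T),
      hF.integral_eq φ hφ hφk hφT, integral_primitive_mul_deriv hq' hφ hφT,
      sub_neg_eq_add, neg_add_eq_zero]
    rw [intervalIntegral.integral_of_le hT.le, intervalIntegral.integral_of_le hT.le,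
      integral_Ioc_eq_integral_Ioo, integral_Ioc_eq_integral_Ioo]
    refine setIntegral_congr_ae measurableSet_Ioo ?_
    filter_upwards [hgq] with t ht htT
    rw [ht htT, trunc_of_mem _ htT]
  have hC0 : C = 0 := by
    have h1 : EqOn (fun t => c t - Q t) (fun _ => C) (Ioo 0 T) := by
      refine Measure.eqOn_open_of_ae_eq (μ := volume) ?_ isOpen_Ioo
        ((hc.mono Ioo_subset_Icc_self).sub hQc.continuousOn) continuousOn_const
      refine (ae_restrict_iff' measurableSet_Ioo).2 ?_
      filter_upwards [hC, hFc] with t h2 h3 htT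
      rw [← h3 htT, h2 htT]
    have h2 : EqOn (fun t => c t - Q t) (fun _ => C) (Icc 0 T) := by
      have := h1.of_subset_closure (hc.sub hQc.continuousOn) continuousOn_const
        Ioo_subset_Icc_self (by rw [closure_Ioo hT.ne])
      exact this
    have h3 := h2 (left_mem_Icc.2 hT.le)
    simp only [hc0, hQ, intervalIntegral.integral_same, sub_zero] at h3
    exact h3.symm
  have hKpQ : ∀ᵐ s, s < T → (trunc T k ⋆[lsmul ℝ ℝ, volume] trunc T p) s =
      (trunc T (fun _ => (1 : ℝ)) ⋆[lsmul ℝ ℝ, volume] trunc T q) s := by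
    filter_upwards [hC, hFK] with s h1 h2 hsT
    rcases le_or_gt s 0 with h | h
    · rw [convolution_eq_zero, convolution_eq_zero] <;>
        first | exact h | exact fun _ => trunc_eq_zero_of_nonpos _
    · have hs : s ∈ Ioo 0 T := ⟨h, hsT⟩
      rw [convolution_one (fun _ => trunc_eq_zero_of_nonpos _) hs, ← h2 hs]
      linarith [h1 hs]
  have hLq0 : ∀ s ≤ 0, (trunc T l ⋆[lsmul ℝ ℝ, volume] trunc T q) s = 0 := fun s hs =>
    convolution_eq_zero (fun _ => trunc_eq_zero_of_nonpos _) (fun _ => trunc_eq_zero_of_nonpos _) hs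
  -- `1 * (p - l * q) = 0`, by associativity from `1 * p = (l * k) * p = l * (1 * q)`
  have hzero := ae_eq_zero_of_ae_primitive_eq_zero (T := T) (hp'.sub hLq) (by
    filter_upwards [convolution_assoc_ae hL hK hp', convolution_assoc_ae hL h1' hq',
      convolution_assoc_ae h1' hL hq'] with t e1 e2 e3 htT
    simp only [Pi.sub_apply]
    rw [intervalIntegral.integral_sub hp'.intervalIntegrable hLq.intervalIntegrable,
      ← convolution_one (fun _ => trunc_eq_zero_of_nonpos _) htT, ← convolution_one hLq0 htT,
      sub_eq_zero, ← e3, convolution_comm_real (trunc T fun _ => (1 : ℝ)) (trunc T l), e2,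
      ← convolution_congr_right hKpQ (fun _ => trunc_eq_zero_of_nonpos _) htT.2.le, ← e1,
      convolution_comm_real (trunc T l) (trunc T k),
      convolution_congr_left (hkl.convolution_trunc T) (fun _ => trunc_eq_zero_of_nonpos _)
        htT.2.le])
  filter_upwards [hzero] with t ht htT
  have := ht htT
  rw [conv_eq_convolution l q htT, ← sub_eq_zero, ← this, Pi.sub_apply, trunc_of_mem p htT]

end Representation

/-! ### Half-line convolution of square-integrable functions -/

section ConvAE

variable {E F : Type*} [NormedAddCommGroup E] [NormedSpace ℝ E] [NormedAddCommGroup F]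
  [NormedSpace ℝ F]

lemma ae_intervalIntegrable_conv {k : ℝ → ℝ} (hk : LocallyIntegrableOn k (Ici 0)) {T : ℝ}
    {g : ℝ → E} (hg : IntegrableOn g (Ioo 0 T)) :
    ∀ᵐ t, t ∈ Ioo 0 T → IntervalIntegrable (fun τ => k (t - τ) • g τ) volume 0 t := by
  have hK := integrable_trunc_of_locallyIntegrableOn hk T
  filter_upwards [hK.ae_convolution_exists (lsmul ℝ ℝ) (integrable_trunc hg)] with t ht htT
  rw [intervalIntegrable_iff_integrableOn_Ioo_of_le htT.1.le,
    ← integrable_indicator_iff measurableSet_Ioo]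
  refine ht.integrable_swap.congr (.of_forall fun τ => ?_)
  rw [conv_integrand_eq k g htT]
  rfl

/-- Bounded operators commute with the convolution wherever its integral converges. -/
lemma ae_map_conv [CompleteSpace E] [CompleteSpace F] (A : E →L[ℝ] F) {k : ℝ → ℝ}
    (hk : LocallyIntegrableOn k (Ici 0)) {T : ℝ} {g : ℝ → E} (hg : IntegrableOn g (Ioo 0 T)) :
    ∀ᵐ t, t ∈ Ioo 0 T → A (conv k g t) = conv k (fun τ => A (g τ)) t := by
  filter_upwards [ae_intervalIntegrable_conv hk hg] with t ht htT
  rw [conv, conv, ← A.intervalIntegral_comp_comm (ht htT)]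
  simp

lemma ae_conv_sub {k : ℝ → ℝ} (hk : LocallyIntegrableOn k (Ici 0)) {T : ℝ} {g g' : ℝ → E}
    (hg : IntegrableOn g (Ioo 0 T)) (hg' : IntegrableOn g' (Ioo 0 T)) :
    ∀ᵐ t, t ∈ Ioo 0 T → conv k (fun τ => g τ - g' τ) t = conv k g t - conv k g' t := by
  filter_upwards [ae_intervalIntegrable_conv hk hg, ae_intervalIntegrable_conv hk hg']
    with t ht ht' htT
  rw [conv, conv, conv, ← intervalIntegral.integral_sub (ht htT) (ht' htT)]
  simp only [smul_sub]

lemma conv_const [CompleteSpace E] (k : ℝ → ℝ) (c : E) (t : ℝ) :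
    conv k (fun _ => c) t = (∫ s in (0 : ℝ)..t, k s) • c := by
  rw [conv, intervalIntegral.integral_smul_const, intervalIntegral.integral_comp_sub_left k t]
  simp

lemma memLp_conv {k : ℝ → ℝ} (hk : LocallyIntegrableOn k (Ici 0)) {T : ℝ} {g : ℝ → E}
    (hg : MemLp g 2 (volume.restrict (Ioo 0 T))) :
    MemLp (conv k g) 2 (volume.restrict (Ioo 0 T)) := by
  have h := (memLp_convolution (integrable_trunc_of_locallyIntegrableOn hk T)
    (memLp_trunc hg)).restrict (Ioo 0 T)
  refine h.ae_eq ((ae_restrict_iff' measurableSet_Ioo).2 (.of_forall fun t ht => ?_))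
  exact (conv_eq_convolution k g ht).symm

end ConvAE

/-! ### The integrated equation tested with `w` -/

section WeakSolution

variable {V H : Type*} [NormedAddCommGroup V] [InnerProductSpace ℝ V] [CompleteSpace V]
  [NormedAddCommGroup H] [InnerProductSpace ℝ H] [CompleteSpace H]

/-- A weak solution satisfies `(u - u₀, v) = ⟨l * f, v⟩ - a(l * w, v)` almost everywhere, for each
`v`. -/
lemma IsWeakSolution.ae_inner_sub_eq {ι : V →L[ℝ] H} {a : V →L[ℝ] V →L[ℝ] ℝ} {k l : ℝ → ℝ}
    (hkl : IsPCPair k l) {T : ℝ} (hT : 0 < T) {u₀ : H} {f : ℝ → StrongDual ℝ V}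
    (hf : IntegrableOn f (Ioo 0 T)) {w : ℝ → V} (hw : IntegrableOn w (Ioo 0 T)) {u : ℝ → H}
    (hu : IntegrableOn u (Ioo 0 T))
    (hku : ∃ g : ℝ → H, ContinuousOn g (Icc 0 T) ∧ g 0 = 0 ∧
      ∀ᵐ t ∂(volume.restrict (Ioo 0 T)), conv k u t = g t)
    (hsol : IsWeakSolution T ι a k u₀ f u w) (v : V) :
    ∀ᵐ t, t ∈ Ioo 0 T →
      inner ℝ (u t - u₀) (ι v) = conv l f t v - a (conv l w t) v := by
  obtain ⟨g, hg, hgae⟩ := hsol v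
  obtain ⟨c, hc, hc0, hkuc⟩ := hku
  have hconst : ∀ x : H, IntegrableOn (fun _ : ℝ => x) (Ioo 0 T) := fun x =>
    integrableOn_const (by simp)
  have hk := hkl.locallyIntegrable_left
  have hl := hkl.locallyIntegrable_right
  have hK := integrable_trunc_of_locallyIntegrableOn hk T
  have huu : IntegrableOn (fun t => u t - u₀) (Ioo 0 T) := hu.sub (hconst u₀)
  set A : H →L[ℝ] ℝ := (innerSL ℝ).flip (ι v) with hA
  have hAa : ∀ x, A x = inner ℝ x (ι v) := fun x => rfl
  set B : StrongDual ℝ V →L[ℝ] ℝ := ContinuousLinearMap.apply ℝ ℝ v with hB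
  have hfv : IntegrableOn (fun t => f t v) (Ioo 0 T) := B.integrable_comp hf
  have hwv : IntegrableOn (fun t => a (w t) v) (Ioo 0 T) := (a.flip v).integrable_comp hw
  have hrep := ae_eq_conv_of_hasGeneralizedDeriv hkl hT (A.integrable_comp huu) (hfv.sub hwv)
    (F := fun t => inner ℝ (conv k (fun τ => u τ - u₀) t) (ι v)) (g := g)
    (c := fun t => A (c t - (∫ s in (0 : ℝ)..t, trunc T k s) • u₀))
    (ae_map_conv A hk huu) hg ?_ ?_ ?_ ?_
  · filter_upwards [hrep, ae_conv_sub hl hfv hwv, ae_map_conv B hl hf,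
      ae_map_conv (a.flip v) hl hw] with t h1 h2 h3 h4 htT
    have h1 := h1 htT
    rw [show (fun t => f t v) - (fun t => a (w t) v) = fun t => f t v - a (w t) v from rfl,
      h2 htT] at h1
    have h3 := h3 htT
    have h4 := h4 htT
    simp only [hB, ContinuousLinearMap.apply_apply, flip_apply] at h3 h4
    rw [h3, h4, ← h1]
    rfl
  · filter_upwards [(ae_restrict_iff' measurableSet_Ioo).1 hgae] with t ht htT
    simp only [Pi.sub_apply]
    linarith [ht htT]
  · refine A.continuous.comp_continuousOn (hc.sub (ContinuousOn.smul ?_ continuousOn_const))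
    exact (intervalIntegral.continuous_primitive (fun _ _ => hK.intervalIntegrable) 0).continuousOn
  · simp [hc0]
  · filter_upwards [(ae_restrict_iff' measurableSet_Ioo).1 hkuc, ae_conv_sub hk hu (hconst u₀)]
      with t h1 h2 htT
    rw [h2 htT, h1 htT, conv_const, integral_trunc _ (Ioo_subset_Icc_self htT)]
    rfl

/-- The equation may be tested with `w(t)` itself, because by separability of `V` the exceptional
null sets of the individual test vectors can be replaced by a single one. -/
lemma IsWeakSolution.ae_inner_sub_self_eq [TopologicalSpace.SeparableSpace V] {ι : V →L[ℝ] H}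
    {a : V →L[ℝ] V →L[ℝ] ℝ} {k l : ℝ → ℝ}
    (hkl : IsPCPair k l) {T : ℝ} (hT : 0 < T) {u₀ : H} {f : ℝ → StrongDual ℝ V}
    (hf : IntegrableOn f (Ioo 0 T)) {w : ℝ → V} (hw : IntegrableOn w (Ioo 0 T)) {u : ℝ → H}
    (hu : IntegrableOn u (Ioo 0 T))
    (hku : ∃ g : ℝ → H, ContinuousOn g (Icc 0 T) ∧ g 0 = 0 ∧
      ∀ᵐ t ∂(volume.restrict (Ioo 0 T)), conv k u t = g t)
    (hsol : IsWeakSolution T ι a k u₀ f u w) :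
    ∀ᵐ t, t ∈ Ioo 0 T →
      inner ℝ (u t - u₀) (ι (w t)) = conv l f t (w t) - a (conv l w t) (w t) := by
  have h := ae_all_iff.2 fun n : ℕ =>
    hsol.ae_inner_sub_eq hkl hT hf hw hu hku (TopologicalSpace.denseSeq V n)
  filter_upwards [h] with t ht htT
  have : (fun v => inner ℝ (u t - u₀) (ι v)) = fun v => conv l f t v - a (conv l w t) v := by
    refine Continuous.ext_on (TopologicalSpace.denseRange_denseSeq V) (by fun_prop) (by fun_prop) ?_
    rintro _ ⟨n, rfl⟩
    exact ht n htT
  exact congrFun this (w t)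

end WeakSolution

/-! ### The square root as a bounded operator -/

section Sqrt

lemma isCoercive_shiftedForm {V H : Type*} [NormedAddCommGroup V] [InnerProductSpace ℝ V]
    [NormedAddCommGroup H] [InnerProductSpace ℝ H] {ι : V →L[ℝ] H}
    {a : V →L[ℝ] V →L[ℝ] ℝ} {κ d : ℝ} (hκ : 0 < κ)
    (ha : ∀ v : V, κ * ‖v‖ ^ 2 - d * ‖ι v‖ ^ 2 ≤ a v v) : IsCoercive (shiftedForm ι a d) := by
  refine ⟨κ, hκ, fun v => ?_⟩
  rw [shiftedForm_apply, real_inner_self_eq_norm_sq]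
  nlinarith [ha v]

variable {V H : Type*} [NormedAddCommGroup V] [InnerProductSpace ℝ V] [CompleteSpace V]
  [NormedAddCommGroup H] [InnerProductSpace ℝ H] [CompleteSpace H]

/-- `A^{1/2}` is a bounded linear operator from `V` to `H`. Linearity is read off from
`(A^{1/2} w, A^{1/2} v) = b(w, v)`, by expanding the square norm of the defect. -/
lemma exists_clm_eq_sqrtApply {ι : V →L[ℝ] H} (hι : DenseRange ι) (hinj : Function.Injective ι)
    {b : V →L[ℝ] V →L[ℝ] ℝ} (hsymm : ∀ w v, b w v = b v w) (hb : IsCoercive b) :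
    ∃ S : V →L[ℝ] H, ∀ v, S v = sqrtApply ι b v := by
  have hin := inner_sqrtApply hι hinj hsymm hb
  have hadd : ∀ w v, sqrtApply ι b (w + v) = sqrtApply ι b w + sqrtApply ι b v := by
    intro w v
    rw [← sub_eq_zero, ← inner_self_eq_zero (𝕜 := ℝ)]
    simp only [inner_sub_left, inner_sub_right, inner_add_left, inner_add_right, hin, map_add,
      add_apply]
    ring
  have hsmul : ∀ (c : ℝ) v, sqrtApply ι b (c • v) = c • sqrtApply ι b v := by
    intro c v
    rw [← sub_eq_zero, ← inner_self_eq_zero (𝕜 := ℝ)]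
    simp only [inner_sub_left, inner_sub_right, real_inner_smul_left, real_inner_smul_right, hin,
      map_smul, smul_apply, smul_eq_mul]
    ring
  refine ⟨LinearMap.mkContinuous ⟨⟨sqrtApply ι b, hadd⟩, hsmul⟩ (Real.sqrt ‖b‖) fun v => ?_,
    fun v => rfl⟩
  refine (sq_le_sq₀ (norm_nonneg _) (by positivity)).1 ?_
  change ‖sqrtApply ι b v‖ ^ 2 ≤ _
  rw [mul_pow, Real.sq_sqrt (norm_nonneg b)]
  rw [← real_inner_self_eq_norm_sq, hin, sq, ← mul_assoc]
  exact (le_abs_self _).trans (b.le_opNorm₂ v v)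

end Sqrt

/-! ### The shear of the plane -/

section Shear

/-- The shear `(t, s) ↦ (t + s, s)`. -/
def shear : ℝ × ℝ ≃ᵐ ℝ × ℝ where
  toFun p := (p.1 + p.2, p.2)
  invFun p := (p.1 - p.2, p.2)
  left_inv p := by simp
  right_inv p := by simp
  measurable_toFun := by
    change Measurable fun p : ℝ × ℝ => (p.1 + p.2, p.2)
    fun_prop
  measurable_invFun := by
    change Measurable fun p : ℝ × ℝ => (p.1 - p.2, p.2)
    fun_prop

lemma shear_apply (p : ℝ × ℝ) : shear p = (p.1 + p.2, p.2) := rfl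

lemma measurePreserving_shear : MeasurePreserving shear (volume.prod volume) (volume.prod volume) :=
  measurePreserving_add_prod volume volume

end Shear

/-! ### The correlation of a Lipschitz function -/

section Corr

lemma continuous_of_norm_sub_le {E : Type*} [NormedAddCommGroup E] {y : ℝ → E} {C : ℝ}
    (hC : ∀ s t, ‖y s - y t‖ ≤ C * |s - t|) : Continuous y := by
  refine (LipschitzWith.of_dist_le' (K := C) fun s t => ?_).continuous
  rw [dist_eq_norm, Real.dist_eq]
  exact hC s t

variable {E : Type*} [NormedAddCommGroup E] [NormedSpace ℝ E] {L : ℝ → ℝ} {y : ℝ → E} {B C T : ℝ}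

lemma norm_corr_le (hL : Integrable L) (hB : ∀ t, ‖y t‖ ≤ B) (t : ℝ) :
    ‖corr L y t‖ ≤ (∫ s, ‖L s‖) * B := by
  rw [corr, ← integral_mul_const]
  refine norm_integral_le_of_norm_le (hL.norm.mul_const B) (.of_forall fun s => ?_)
  rw [norm_smul]
  gcongr
  exact hB _

lemma integrable_smul_comp_add (hL : Integrable L) (hy : Continuous y) (hB : ∀ t, ‖y t‖ ≤ B)
    (t : ℝ) : Integrable fun s => L s • y (t + s) := by
  refine (hL.norm.mul_const B).mono' (hL.aestronglyMeasurable.smul (by fun_prop))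
    (.of_forall fun s => ?_)
  rw [norm_smul]
  gcongr
  exact hB _

lemma norm_corr_sub_le (hL : Integrable L) (hy : Continuous y) (hB : ∀ t, ‖y t‖ ≤ B)
    (hC : ∀ s t, ‖y s - y t‖ ≤ C * |s - t|) (s t : ℝ) :
    ‖corr L y s - corr L y t‖ ≤ (∫ s, ‖L s‖) * C * |s - t| := by
  rw [corr, corr, ← integral_sub (integrable_smul_comp_add hL hy hB s)
    (integrable_smul_comp_add hL hy hB t), mul_assoc, ← integral_mul_const]
  refine norm_integral_le_of_norm_le (hL.norm.mul_const _) (.of_forall fun r => ?_)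
  rw [← smul_sub, norm_smul]
  gcongr
  simpa using hC (s + r) (t + r)

lemma continuous_corr (hL : Integrable L) (hy : Continuous y) (hB : ∀ t, ‖y t‖ ≤ B)
    (hC : ∀ s t, ‖y s - y t‖ ≤ C * |s - t|) : Continuous (corr L y) := by
  refine (LipschitzWith.of_dist_le' (K := (∫ s, ‖L s‖) * C) fun s t => ?_).continuous
  rw [dist_eq_norm, Real.dist_eq]
  exact norm_corr_sub_le hL hy hB hC s t

lemma corr_eq_zero_of_le (hL0 : ∀ s ≤ 0, L s = 0) (hyT : ∀ t, T ≤ t → y t = 0) {t : ℝ}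
    (ht : T ≤ t) : corr L y t = 0 := by
  refine integral_eq_zero_of_ae (.of_forall fun s => ?_)
  rcases le_or_gt s 0 with h | h
  · simp [hL0 s h]
  · simp [hyT (t + s) (by linarith)]

/-- The dual form of `k * l = 1`: correlating `corr L y` with `K` integrates `y` up to `T`. -/
lemma corr_corr_eq_integral [CompleteSpace E] {K : ℝ → ℝ} (hT : 0 < T) (hK : Integrable K)
    (hL : Integrable L)
    (hKL : ∀ᵐ s, s < T → (K ⋆[lsmul ℝ ℝ, volume] L) s = trunc T (fun _ => (1 : ℝ)) s)
    (hy : Continuous y) (hB : ∀ t, ‖y t‖ ≤ B) (hyT : ∀ t, T ≤ t → y t = 0) {t : ℝ} (ht : 0 ≤ t) :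
    corr K (corr L y) t = ∫ r in t..T, y r := by
  have h1 : (fun x => corr L y (-x)) = (L ⋆[lsmul ℝ ℝ, volume] fun x => y (-x)) := by
    ext x
    rw [corr_eq_convolution, neg_neg]
  rw [corr_eq_convolution, h1, ← convolution_assoc_of_bounded hK hL (by fun_prop)
    (B := B) (fun t => hB _), convolution_lsmul]
  have hyi : ∀ a b, IntervalIntegrable y volume a b := fun a b => hy.intervalIntegrable a b
  have h2 : ∫ r in t..T, y r = ∫ r in t..(T + t), y r := by
    rw [← intervalIntegral.integral_add_adjacent_intervals (hyi t T) (hyi T (T + t)), left_eq_add]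
    refine intervalIntegral.integral_zero_ae (.of_forall fun s hs => hyT s ?_)
    rw [uIoc_of_le (by linarith)] at hs
    exact hs.1.le
  have h3 : ∫ r in t..(T + t), y r = ∫ r in (0 : ℝ)..T, y (r + t) := by
    rw [intervalIntegral.integral_comp_add_right, zero_add]
  rw [h2, h3, intervalIntegral.integral_of_le hT.le, integral_Ioc_eq_integral_Ioo,
    ← integral_indicator measurableSet_Ioo]
  refine integral_congr_ae ?_
  filter_upwards [hKL] with s hs
  have h4 : y (-(-t - s)) = y (s + t) := by congr 1; ring
  rw [h4]
  rcases lt_or_ge s T with h | h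
  · rw [hs h]
    by_cases hsT : s ∈ Ioo 0 T
    · rw [trunc_of_mem _ hsT, indicator_of_mem hsT, one_smul]
    · rw [trunc_of_notMem _ hsT, indicator_of_notMem hsT, zero_smul]
  · rw [hyT (s + t) (by linarith), smul_zero,
      indicator_of_notMem fun h' => absurd h'.2 (not_lt.2 h)]

/-- The difference quotient of the kernel against the dual convolution is the increment of the
primitive. -/
lemma integral_sub_smul_corr [CompleteSpace E] {K : ℝ → ℝ} (hT : 0 < T) (hK : Integrable K)
    (hL : Integrable L)
    (hKL : ∀ᵐ s, s < T → (K ⋆[lsmul ℝ ℝ, volume] L) s = trunc T (fun _ => (1 : ℝ)) s)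
    (hC : ∀ s t, ‖y s - y t‖ ≤ C * |s - t|) (hB : ∀ t, ‖y t‖ ≤ B) (hyT : ∀ t, T ≤ t → y t = 0)
    {t h : ℝ} (ht : 0 ≤ t) (hh : 0 ≤ h) :
    ∫ s, (K s - K (s - h)) • corr L y (t + s) = ∫ r in t..(t + h), y r := by
  have hy := continuous_of_norm_sub_le hC
  have hG := continuous_corr hL hy hB hC
  have hGB := norm_corr_le hL hB
  have h1 : ∫ s, K (s - h) • corr L y (t + s) = corr K (corr L y) (t + h) := by
    rw [corr, ← integral_sub_right_eq_self (fun x => K x • corr L y (t + h + x)) h]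
    simp only [add_add_sub_cancel]
  have hyi : ∀ a b, IntervalIntegrable y volume a b := fun a b => hy.intervalIntegrable a b
  simp_rw [sub_smul]
  rw [integral_sub (integrable_smul_comp_add hK hG hGB t), h1,
    corr_corr_eq_integral hT hK hL hKL hy hB hyT (by positivity),
    ← intervalIntegral.integral_interval_sub_left (hyi T (t + h)) (hyi T t),
    intervalIntegral.integral_symm t T, intervalIntegral.integral_symm (t + h) T]
  · change corr K (corr L y) t - _ = _
    rw [corr_corr_eq_integral hT hK hL hKL hy hB hyT ht]
    abel
  · have := integrable_smul_comp_add (hK.comp_sub_right h) hG hGB t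
    exact this

end Corr

/-! ### Difference quotients of a convex kernel -/

section Kernel

variable {k : ℝ → ℝ} {T h : ℝ}

/-- The weight `(k(s) - k(2s)) / s`, which is minus the slope of the chord of `k` over `[s, 2s]`. -/
noncomputable def slopeWeight (k : ℝ → ℝ) (s : ℝ) : ℝ := 1 / s * (k s - k (2 * s))

lemma slopeWeight_nonneg (hk : AntitoneOn k (Ioi 0)) {s : ℝ} (hs : 0 < s) :
    0 ≤ slopeWeight k s := by
  have := hk (mem_Ioi.2 hs) (mem_Ioi.2 (by positivity : 0 < 2 * s)) (by linarith)
  exact mul_nonneg (by positivity) (by linarith)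

lemma slopeWeight_le (hk0 : ∀ t, 0 < t → 0 ≤ k t) (hk : AntitoneOn k (Ioi 0)) (hh : 0 < h) {s : ℝ}
    (hs : h < s) : slopeWeight k s ≤ 1 / h * k h := by
  have h1 := hk (mem_Ioi.2 hh) (mem_Ioi.2 (hh.trans hs)) hs.le
  have h2 := hk0 (2 * s) (by linarith)
  have h3 := hk0 h hh
  have h4 := hk0 s (by linarith)
  unfold slopeWeight
  have h5 : 1 / s ≤ 1 / h := one_div_le_one_div_of_le hh hs.le
  calc 1 / s * (k s - k (2 * s)) ≤ 1 / s * k h := by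
        gcongr
        · exact one_div_nonneg.2 (by linarith)
        · linarith
    _ ≤ 1 / h * k h := by gcongr

/-- By convexity the chord of `k` over `[s - h, s]` is at least as steep as the one over
`[s, 2s]`. -/
lemma mul_slopeWeight_le (hk : ConvexOn ℝ (Ioi 0) k) (hh : 0 < h) {s : ℝ} (hs : h < s) :
    h * slopeWeight k s ≤ k (s - h) - k s := by
  have h1 := hk.slope_mono_adjacent (x := s - h) (y := s) (z := 2 * s) (mem_Ioi.2 (by linarith))
    (mem_Ioi.2 (by linarith)) (by linarith) (by linarith)
  have h2 : s - (s - h) = h := by ring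
  have h3 : 2 * s - s = s := by ring
  rw [h2, h3, div_le_iff₀ hh] at h1
  have h4 : h * slopeWeight k s = -((k (2 * s) - k s) / s * h) := by
    unfold slopeWeight
    ring
  linarith

lemma measurable_slopeWeight (hk : Measurable k) : Measurable (slopeWeight k) := by
  unfold slopeWeight
  fun_prop

/-- Integrating the backward difference of `k` over `(0, r)` leaves the integral of `k` over
`(r - h, r)`, which by monotonicity is at least `h k(r)`. -/
lemma mul_indicator_le_integral_sub (hk0 : ∀ t, 0 < t → 0 ≤ k t) (hk : AntitoneOn k (Ioi 0))
    (hK : Integrable (trunc T k)) (hh : 0 < h) {r : ℝ} (hr : r ∈ Ioo 0 T) :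
    h * (Ioi h).indicator k r ≤ ∫ s in (0 : ℝ)..r, (trunc T k s - trunc T k (s - h)) := by
  have hi : ∀ a b, IntervalIntegrable (trunc T k) volume a b := fun a b => hK.intervalIntegrable
  have hpos : ∀ s, 0 ≤ trunc T k s := fun s => indicator_nonneg (fun s hs => hk0 s hs.1) s
  have h0 : ∫ s in (-h)..0, trunc T k s = 0 := by
    refine intervalIntegral.integral_zero_ae (.of_forall fun s hs => ?_)
    rw [uIoc_of_le (by linarith)] at hs
    exact trunc_eq_zero_of_nonpos k hs.2
  have h1 : ∫ s in (0 : ℝ)..r, (trunc T k s - trunc T k (s - h)) =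
      ∫ s in (r - h)..r, trunc T k s := by
    rw [intervalIntegral.integral_sub (hi 0 r) (hK.comp_sub_right h).intervalIntegrable,
      intervalIntegral.integral_comp_sub_right (trunc T k) h, zero_sub,
      ← intervalIntegral.integral_add_adjacent_intervals (hi (-h) 0) (hi 0 (r - h)), h0, zero_add,
      intervalIntegral.integral_interval_sub_left (hi _ _) (hi _ _)]
  rw [h1]
  by_cases hrh : h < r
  · rw [indicator_of_mem (mem_Ioi.2 hrh)]
    have h2 : h * k r = ∫ _ in (r - h)..r, k r := by simp
    rw [h2]
    refine intervalIntegral.integral_mono_on (by linarith) intervalIntegrable_const (hi _ _) ?_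
    intro s hs
    have hs0 : 0 < s := by linarith [hs.1]
    rw [trunc_of_mem k ⟨hs0, hs.2.trans_lt hr.2⟩]
    exact hk hs0 hr.1 hs.2
  · rw [indicator_of_notMem (by simpa using hrh), mul_zero]
    exact intervalIntegral.integral_nonneg (by linarith) fun s _ => hpos s

end Kernel

/-! ### The difference kernel -/

section Core

variable {H : Type*} [NormedAddCommGroup H] [InnerProductSpace ℝ H]
  {k L : ℝ → ℝ} {y : ℝ → H} {B C T h : ℝ}

/-- The difference kernel `k(s) - k(s - h)` at `s = p.2`, restricted to `p.1 ∈ (0, T)`. -/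
noncomputable def diffKernel (T : ℝ) (k : ℝ → ℝ) (h : ℝ) (p : ℝ × ℝ) : ℝ :=
  trunc T (fun _ => (1 : ℝ)) p.1 * (trunc T k p.2 - trunc T k (p.2 - h))

lemma integrable_trunc_one (T : ℝ) : Integrable (trunc T fun _ => (1 : ℝ)) :=
  integrable_trunc (integrableOn_const (by simp))

lemma integrable_diffKernel_mul (hK : Integrable (trunc T k)) (h : ℝ) {φ : ℝ × ℝ → ℝ} {c : ℝ}
    (hφ : Measurable φ) (hc : ∀ p, |φ p| ≤ c) :
    Integrable (fun p => diffKernel T k h p * φ p) (volume.prod volume) :=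
  ((integrable_trunc_one T).mul_prod (hK.sub (hK.comp_sub_right h))).mul_bdd
    hφ.aestronglyMeasurable (.of_forall hc)

/-- The difference kernel tested against `(G(t), G(t + s))`, with `G = corr L y`, tests `G(t)`
against the integral of `y` over `(t, t + h)`. -/
lemma integral_diffKernel_mul_inner [CompleteSpace H] (hT : 0 < T) (hK : Integrable (trunc T k))
    (hL : Integrable L)
    (hKL : ∀ᵐ s, s < T → (trunc T k ⋆[lsmul ℝ ℝ, volume] L) s = trunc T (fun _ => (1 : ℝ)) s)
    (hC : ∀ s t, ‖y s - y t‖ ≤ C * |s - t|) (hB : ∀ t, ‖y t‖ ≤ B) (hyT : ∀ t, T ≤ t → y t = 0)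
    (hh : 0 ≤ h) (hmeas : Measurable fun p : ℝ × ℝ => inner ℝ (corr L y p.1) (corr L y (p.1 + p.2)))
    {c : ℝ} (hc : ∀ s t, |inner ℝ (corr L y s) (corr L y t)| ≤ c) :
    ∫ p, diffKernel T k h p * inner ℝ (corr L y p.1) (corr L y (p.1 + p.2)) ∂(volume.prod volume) =
      ∫ t in Ioo 0 T, inner ℝ (corr L y t) (∫ r in t..(t + h), y r) := by
  have hy := continuous_of_norm_sub_le hC
  have hG := continuous_corr hL hy hB hC
  rw [integral_prod _ (integrable_diffKernel_mul hK h hmeas fun p => hc _ _),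
    ← integral_indicator measurableSet_Ioo]
  congr 1
  ext t
  by_cases ht : t ∈ Ioo 0 T
  · rw [indicator_of_mem ht, ← integral_sub_smul_corr hT hK hL hKL hC hB hyT ht.1.le hh,
      ← integral_inner]
    · simp [diffKernel, trunc_of_mem _ ht, real_inner_smul_right]
    · exact integrable_smul_comp_add (hK.sub (hK.comp_sub_right h)) hG (norm_corr_le hL hB) t
  · simp [indicator_of_notMem ht, diffKernel, trunc_of_notMem _ ht]

/-- Integrating the difference kernel over `0 < s < r(t)` gives back the kernel at `r(t)`. -/
lemma integral_weight_le_integral_diffKernel (hkm : Measurable k) (hk0 : ∀ t, 0 < t → 0 ≤ k t)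
    (hk : AntitoneOn k (Ioi 0)) (hK : Integrable (trunc T k)) (hh : 0 < h) {N r : ℝ → ℝ} {c : ℝ}
    (hN : Measurable N) (hN0 : ∀ t, 0 ≤ N t) (hNc : ∀ t, N t ≤ c) (hr : Measurable r)
    (hrT : ∀ t ∈ Ioo 0 T, r t ∈ Ioo 0 T) :
    ∫ t in Ioo 0 T, h * (Ioi h).indicator k (r t) * N t ≤
      ∫ p, diffKernel T k h p * ({p : ℝ × ℝ | 0 < p.2 ∧ p.2 < r p.1}.indicator 1 p * N p.1)
        ∂(volume.prod volume) := by
  have hms : MeasurableSet {p : ℝ × ℝ | 0 < p.2 ∧ p.2 < r p.1} := by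
    refine (measurableSet_lt measurable_const measurable_snd).inter ?_
    exact measurableSet_lt measurable_snd (hr.comp measurable_fst)
  have hint : Integrable (fun p => diffKernel T k h p *
      ({p : ℝ × ℝ | 0 < p.2 ∧ p.2 < r p.1}.indicator 1 p * N p.1)) (volume.prod volume) := by
    refine integrable_diffKernel_mul hK h (c := c)
      ((measurable_one.indicator hms).mul (hN.comp measurable_fst)) fun p => ?_
    have h1 : 0 ≤ {p : ℝ × ℝ | 0 < p.2 ∧ p.2 < r p.1}.indicator (1 : ℝ × ℝ → ℝ) p :=
      indicator_nonneg (fun _ _ => zero_le_one) p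
    have h2 : {p : ℝ × ℝ | 0 < p.2 ∧ p.2 < r p.1}.indicator (1 : ℝ × ℝ → ℝ) p ≤ 1 :=
      indicator_le_self' (fun _ _ => zero_le_one) p
    rw [abs_of_nonneg (mul_nonneg h1 (hN0 _))]
    calc _ ≤ 1 * N p.1 := by gcongr; exact hN0 _
      _ ≤ c := by rw [one_mul]; exact hNc _
  rw [integral_prod _ hint, ← integral_indicator measurableSet_Ioo]
  have hkh : ∀ s, 0 ≤ (Ioi h).indicator k s := fun s =>
    indicator_nonneg (fun s hs => hk0 s (hh.trans hs)) s
  have hkh' : ∀ s, (Ioi h).indicator k s ≤ k h := fun s => by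
    refine indicator_le' (fun s hs => ?_) (fun s _ => hk0 h hh) s
    exact hk hh (hh.trans hs) (le_of_lt hs)
  refine integral_mono ?_ hint.integral_prod_left fun t => ?_
  · refine (integrable_indicator_iff measurableSet_Ioo).2 ?_
    refine IntegrableOn.of_bound (by simp) (Measurable.aestronglyMeasurable ?_) (h * k h * c)
      (.of_forall fun t => ?_)
    · exact (((hkm.indicator measurableSet_Ioi).comp hr).const_mul h).mul hN
    · rw [Real.norm_of_nonneg (mul_nonneg (mul_nonneg hh.le (hkh _)) (hN0 _))]
      have := hk0 h hh
      gcongr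
      · exact hN0 t
      · exact hkh' _
      · exact hNc t
  · by_cases ht : t ∈ Ioo 0 T
    · simp only [indicator_of_mem ht]
      have h1 : ∀ s, diffKernel T k h (t, s) *
          ({p : ℝ × ℝ | 0 < p.2 ∧ p.2 < r p.1}.indicator 1 (t, s) * N t) =
          (Ioo 0 (r t)).indicator (fun s => trunc T k s - trunc T k (s - h)) s * N t := by
        intro s
        by_cases hs : s ∈ Ioo 0 (r t)
        · rw [indicator_of_mem hs, indicator_of_mem (by exact hs)]
          simp [diffKernel, trunc_of_mem _ ht]
        · rw [indicator_of_notMem hs, indicator_of_notMem (by exact hs)]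
          simp
      simp_rw [h1]
      rw [integral_mul_const, integral_indicator measurableSet_Ioo,
        ← integral_Ioc_eq_integral_Ioo, ← intervalIntegral.integral_of_le (hrT t ht).1.le]
      gcongr
      · exact hN0 t
      · exact mul_indicator_le_integral_sub hk0 hk hK hh (hrT t ht)
    · simp [indicator_of_notMem ht, diffKernel, trunc_of_notMem _ ht]

end Core

/-! ### The weighted inequality for a fixed step -/

section Core

variable {H : Type*} [NormedAddCommGroup H] [InnerProductSpace ℝ H]
  {k L : ℝ → ℝ} {y G : ℝ → H} {B C T h : ℝ}

/-- The triangle `0 < s < t < T`. -/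
def triangle (T : ℝ) : Set (ℝ × ℝ) := {p | 0 < p.2 ∧ p.2 < p.1 ∧ p.1 < T}

lemma measurableSet_triangle (T : ℝ) : MeasurableSet (triangle T) :=
  (measurableSet_lt measurable_const measurable_snd).inter
    ((measurableSet_lt measurable_snd measurable_fst).inter
      (measurableSet_lt measurable_fst measurable_const))

lemma volume_triangle_lt_top (T : ℝ) : (volume.prod volume) (triangle T) < ⊤ := by
  refine (measure_mono (t := Ioo 0 T ×ˢ Ioo 0 T) fun p hp => ?_).trans_lt ?_
  · exact ⟨⟨hp.1.trans hp.2.1, hp.2.2⟩, hp.1, hp.2.1.trans hp.2.2⟩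
  · rw [Measure.prod_prod]
    exact ENNReal.mul_lt_top (by simp) (by simp)

/-- The pointwise inequality behind the energy estimate. On the triangle `0 < t`, `0 < s`,
`t + s < T` the inner product is polarized, and the difference kernel is negative for `s > h`,
where convexity bounds it by the slope weight. For `s ≤ h` it is positive; there the Lipschitz
bound makes the error quadratic in `h`. -/
lemma diffKernel_mul_inner_ge (hk0 : ∀ t, 0 < t → 0 ≤ k t)
    (hkc : ConvexOn ℝ (Ioi 0) k) (hh : 0 < h) (hGT : ∀ t, T ≤ t → G t = 0)
    (hGC : ∀ s t, ‖G s - G t‖ ≤ C * |s - t|) (p : ℝ × ℝ) :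
    diffKernel T k h p * ({p : ℝ × ℝ | 0 < p.2 ∧ p.2 < T - p.1}.indicator 1 p * ‖G p.1‖ ^ 2) +
      diffKernel T k h p *
        ({p : ℝ × ℝ | 0 < p.2 ∧ p.2 < T - p.1}.indicator 1 p * ‖G (p.1 + p.2)‖ ^ 2) +
      h * (triangle T).indicator (fun q => (Ioi h).indicator (slopeWeight k) q.2 *
        ‖G q.1 - G (q.1 - q.2)‖ ^ 2) (shear p) -
      trunc T (fun _ => (1 : ℝ)) p.1 * trunc T k p.2 * (C * h) ^ 2 ≤
    2 * (diffKernel T k h p * inner ℝ (G p.1) (G (p.1 + p.2))) := by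
  obtain ⟨t, s⟩ := p
  have hKpos : ∀ s, 0 ≤ trunc T k s := fun s => indicator_nonneg (fun s hs => hk0 s hs.1) s
  have hpos : 0 ≤ trunc T k s * (C * h) ^ 2 := mul_nonneg (hKpos s) (sq_nonneg _)
  simp only [shear_apply]
  -- both sides vanish for `t` outside `(0, T)`
  by_cases ht : t ∈ Ioo 0 T
  swap
  · have h1 : (t + s, s) ∉ triangle T := fun h' =>
      ht ⟨by linarith [h'.2.1], by linarith [h'.2.2, h'.1]⟩
    simp [diffKernel, trunc_of_notMem _ ht, indicator_of_notMem h1]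
  simp only [diffKernel, trunc_of_mem _ ht, one_mul]
  -- outside the triangle either both kernel values or `G (t + s)` vanish
  by_cases hs : 0 < s ∧ s < T - t
  swap
  · have h1 : (t + s, s) ∉ triangle T := fun h' => hs ⟨h'.1, by linarith [h'.2.2]⟩
    have h2 : (t, s) ∉ {p : ℝ × ℝ | 0 < p.2 ∧ p.2 < T - p.1} := hs
    have h3 : (trunc T k s - trunc T k (s - h)) * inner ℝ (G t) (G (t + s)) = 0 := by
      rcases le_or_gt s 0 with h | h
      · rw [trunc_eq_zero_of_nonpos k h, trunc_eq_zero_of_nonpos k (by linarith)]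
        simp
      · rw [hGT (t + s) (by by_contra! h'; exact hs ⟨h, by linarith⟩)]
        simp
    rw [indicator_of_notMem h1, indicator_of_notMem h2, h3]
    simpa using hpos
  · have h1 : (t + s, s) ∈ triangle T := ⟨hs.1, by linarith [ht.1], by linarith [hs.2]⟩
    have h2 : (t, s) ∈ {p : ℝ × ℝ | 0 < p.2 ∧ p.2 < T - p.1} := hs
    have hsT : s ∈ Ioo 0 T := ⟨hs.1, by linarith [hs.2, ht.1]⟩
    rw [indicator_of_mem h1, indicator_of_mem h2]
    simp only [add_sub_cancel_right, Pi.one_apply, one_mul]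
    have hpol : 2 * inner ℝ (G t) (G (t + s)) =
        ‖G t‖ ^ 2 + ‖G (t + s)‖ ^ 2 - ‖G (t + s) - G t‖ ^ 2 := by
      rw [norm_sub_sq_real, real_inner_comm]
      ring
    have hsq := sq_nonneg ‖G (t + s) - G t‖
    suffices hmain : h * ((Ioi h).indicator (slopeWeight k) s * ‖G (t + s) - G t‖ ^ 2) -
        trunc T k s * (C * h) ^ 2 ≤
        -((trunc T k s - trunc T k (s - h)) * ‖G (t + s) - G t‖ ^ 2) by
      have : 2 * ((trunc T k s - trunc T k (s - h)) * inner ℝ (G t) (G (t + s))) =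
          (trunc T k s - trunc T k (s - h)) * (‖G t‖ ^ 2 + ‖G (t + s)‖ ^ 2 -
            ‖G (t + s) - G t‖ ^ 2) := by
        rw [← hpol]
        ring
      rw [this]
      linarith
    by_cases hsh : h < s
    · rw [indicator_of_mem (mem_Ioi.2 hsh), trunc_of_mem k hsT,
        trunc_of_mem k ⟨by linarith, by linarith [hsT.2]⟩]
      rw [trunc_of_mem k hsT] at hpos
      have h3 := mul_le_mul_of_nonneg_right (mul_slopeWeight_le hkc hh hsh) hsq
      linarith
    · rw [indicator_of_notMem (by simpa using hsh), trunc_eq_zero_of_nonpos k (s := s - h)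
        (by linarith)]
      have h3 : ‖G (t + s) - G t‖ ^ 2 ≤ (C * h) ^ 2 := by
        have h4 := hGC (t + s) t
        rw [add_sub_cancel_left, abs_of_pos hs.1] at h4
        have hC0 : 0 ≤ C := by
          by_contra! hC
          have := (norm_nonneg _).trans h4
          nlinarith [hs.1]
        gcongr
        exact h4.trans (by gcongr; linarith)
      have := mul_le_mul_of_nonneg_left h3 (hKpos s)
      linarith

/-- The integrated inequality for a fixed step `h`. The two diagonal terms of the polarization give
the weights `k(T - t)` and `k(t)`, the latter after the shear `(t, s) ↦ (t + s, s)`, and the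
increment term gives the slope weight. -/
lemma integral_weights_le (hkm : Measurable k) (hk0 : ∀ t, 0 < t → 0 ≤ k t)
    (hk : AntitoneOn k (Ioi 0)) (hkc : ConvexOn ℝ (Ioi 0) k) (hT : 0 < T)
    (hK : Integrable (trunc T k)) (hh : 0 < h) (hG : Continuous G)
    (hGB : ∀ t, ‖G t‖ ≤ B) (hGT : ∀ t, T ≤ t → G t = 0) (hGC : ∀ s t, ‖G s - G t‖ ≤ C * |s - t|) :
    h * (∫ t in Ioo 0 T, (Ioi h).indicator k (T - t) * ‖G t‖ ^ 2) +
      h * (∫ t in Ioo 0 T, (Ioi h).indicator k t * ‖G t‖ ^ 2) +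
      h * (∫ p in triangle T, (Ioi h).indicator (slopeWeight k) p.2 *
        ‖G p.1 - G (p.1 - p.2)‖ ^ 2) ≤
    2 * (∫ p, diffKernel T k h p * inner ℝ (G p.1) (G (p.1 + p.2)) ∂(volume.prod volume)) +
      T * (∫ s, trunc T k s) * (C * h) ^ 2 := by
  have hN : Measurable fun t => ‖G t‖ ^ 2 := (hG.norm.pow 2).measurable
  have hNB : ∀ t, ‖G t‖ ^ 2 ≤ B ^ 2 := fun t => by
    gcongr
    exact hGB t
  have hms : MeasurableSet {p : ℝ × ℝ | 0 < p.2 ∧ p.2 < T - p.1} := by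
    refine (measurableSet_lt measurable_const measurable_snd).inter ?_
    exact measurableSet_lt measurable_snd (measurable_fst.const_sub T)
  have hbd : ∀ p : ℝ × ℝ, ∀ t, |{p : ℝ × ℝ | 0 < p.2 ∧ p.2 < T - p.1}.indicator (1 : ℝ × ℝ → ℝ) p *
      ‖G t‖ ^ 2| ≤ B ^ 2 := by
    intro p t
    by_cases hp : p ∈ {p : ℝ × ℝ | 0 < p.2 ∧ p.2 < T - p.1}
    · rw [indicator_of_mem hp, Pi.one_apply, one_mul, abs_of_nonneg (sq_nonneg _)]
      exact hNB t
    · rw [indicator_of_notMem hp, zero_mul, abs_zero]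
      exact sq_nonneg B
  have i1 : Integrable (fun p => diffKernel T k h p *
      ({p : ℝ × ℝ | 0 < p.2 ∧ p.2 < T - p.1}.indicator 1 p * ‖G p.1‖ ^ 2)) (volume.prod volume) :=
    integrable_diffKernel_mul hK h ((measurable_one.indicator hms).mul (hN.comp measurable_fst))
      fun p => hbd p _
  have i2 : Integrable (fun p => diffKernel T k h p *
      ({p : ℝ × ℝ | 0 < p.2 ∧ p.2 < T - p.1}.indicator 1 p * ‖G (p.1 + p.2)‖ ^ 2))
      (volume.prod volume) :=
    integrable_diffKernel_mul hK h ((measurable_one.indicator hms).mul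
      (hN.comp (measurable_fst.add measurable_snd))) fun p => hbd p _
  have hslope : Measurable ((Ioi h).indicator (slopeWeight k)) :=
    (measurable_slopeWeight hkm).indicator measurableSet_Ioi
  have hGm : Measurable fun q : ℝ × ℝ => ‖G q.1 - G (q.1 - q.2)‖ ^ 2 := by
    have : Continuous fun q : ℝ × ℝ => ‖G q.1 - G (q.1 - q.2)‖ ^ 2 := by fun_prop
    exact this.measurable
  have i3' : Integrable ((triangle T).indicator (fun q => (Ioi h).indicator (slopeWeight k) q.2 *
      ‖G q.1 - G (q.1 - q.2)‖ ^ 2)) (volume.prod volume) := by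
    refine (integrable_indicator_iff (measurableSet_triangle T)).2 ?_
    refine IntegrableOn.of_bound (volume_triangle_lt_top T)
      ((hslope.comp measurable_snd).mul hGm).aestronglyMeasurable (1 / h * k h * (B + B) ^ 2)
      (.of_forall fun q => ?_)
    have h1 : 0 ≤ (Ioi h).indicator (slopeWeight k) q.2 :=
      indicator_nonneg (fun s hs => slopeWeight_nonneg hk (hh.trans hs)) _
    have h2 : (Ioi h).indicator (slopeWeight k) q.2 ≤ 1 / h * k h :=
      indicator_le' (fun s hs => slopeWeight_le hk0 hk hh hs)
        (fun s _ => mul_nonneg (by positivity) (hk0 h hh)) _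
    rw [Real.norm_of_nonneg (mul_nonneg h1 (sq_nonneg _))]
    have h3 := (norm_sub_le (G q.1) (G (q.1 - q.2))).trans (add_le_add (hGB _) (hGB _))
    have h4 := h1.trans h2
    gcongr
  have i3 := (measurePreserving_shear.integrable_comp_emb
    shear.measurableEmbedding).2 i3'
  have i4 : Integrable (fun p : ℝ × ℝ => trunc T (fun _ => (1 : ℝ)) p.1 * trunc T k p.2 *
      (C * h) ^ 2) (volume.prod volume) :=
    ((integrable_trunc_one T).mul_prod hK).mul_const _
  have i5 : Integrable (fun p => diffKernel T k h p * inner ℝ (G p.1) (G (p.1 + p.2)))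
      (volume.prod volume) := by
    refine integrable_diffKernel_mul hK h (c := B * B) ?_ fun p => ?_
    · have : Continuous fun p : ℝ × ℝ => inner ℝ (G p.1) (G (p.1 + p.2)) := by fun_prop
      exact this.measurable
    · have hB0 := (norm_nonneg _).trans (hGB 0)
      exact (abs_real_inner_le_norm _ _).trans
        (mul_le_mul (hGB _) (hGB _) (norm_nonneg _) hB0)
  have hmono := integral_mono (((i1.add i2).add (i3.const_mul h)).sub i4) (i5.const_mul 2)
    (diffKernel_mul_inner_ge hk0 hkc hh hGT hGC)
  rw [integral_const_mul, integral_sub' ((i1.add i2).add (i3.const_mul h)) i4,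
    integral_add' (i1.add i2) (i3.const_mul h), integral_add' i1 i2, integral_const_mul] at hmono
  have e1 := integral_weight_le_integral_diffKernel hkm hk0 hk hK hh hN
    (fun t => sq_nonneg _) hNB (r := fun t => T - t) (by fun_prop)
    (fun t ht => ⟨by linarith [ht.2], by linarith [ht.1]⟩)
  have e2 := integral_weight_le_integral_diffKernel hkm hk0 hk hK hh hN
    (fun t => sq_nonneg _) hNB (r := fun t => t) (by fun_prop) (fun t ht => ht)
  have e2' : ∫ p, diffKernel T k h p *
      ({p : ℝ × ℝ | 0 < p.2 ∧ p.2 < T - p.1}.indicator 1 p * ‖G (p.1 + p.2)‖ ^ 2)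
        ∂(volume.prod volume) =
      ∫ p, diffKernel T k h p * ({p : ℝ × ℝ | 0 < p.2 ∧ p.2 < p.1}.indicator 1 p * ‖G p.1‖ ^ 2)
        ∂(volume.prod volume) := by
    refine Eq.trans (integral_congr_ae (.of_forall ?_))
      (measurePreserving_shear.integral_comp' (f := shear) _)
    rintro ⟨t, s⟩
    simp only [shear_apply, diffKernel, indicator_apply, mem_ofPred_eq, trunc, mem_Ioo,
      Pi.one_apply]
    by_cases hs0 : s ≤ 0
    · simp [not_lt.2 hs0]
    · push Not at hs0
      by_cases ht : 0 < t ∧ s < T - t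
      · rw [if_pos ⟨ht.1, by linarith [ht.2]⟩, if_pos (c := 0 < s ∧ s < T - t) ⟨hs0, ht.2⟩,
          if_pos (c := 0 < t + s ∧ t + s < T) ⟨by linarith [ht.1], by linarith [ht.2]⟩,
          if_pos (c := 0 < s ∧ s < t + s) ⟨hs0, by linarith [ht.1]⟩]
      · have h1 : ¬ ((0 < t ∧ t < T) ∧ (0 < s ∧ s < T - t)) := fun h' => ht ⟨h'.1.1, h'.2.2⟩
        have h2 : ¬ ((0 < t + s ∧ t + s < T) ∧ (0 < s ∧ s < t + s)) := fun h' =>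
          ht ⟨by linarith [h'.2.2], by linarith [h'.1.2]⟩
        rw [not_and_or] at h1 h2
        rcases h1 with h1 | h1 <;> rcases h2 with h2 | h2 <;> simp only [if_neg h1, if_neg h2] <;>
          simp
  have e3 : ∫ p, ((triangle T).indicator (fun q => (Ioi h).indicator (slopeWeight k) q.2 *
      ‖G q.1 - G (q.1 - q.2)‖ ^ 2) ∘ shear) p ∂(volume.prod volume) =
      ∫ p in triangle T, (Ioi h).indicator (slopeWeight k) p.2 *
        ‖G p.1 - G (p.1 - p.2)‖ ^ 2 := by
    rw [← integral_indicator (measurableSet_triangle T)]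
    exact measurePreserving_shear.integral_comp' (f := shear) _
  have e4 : ∫ p : ℝ × ℝ, trunc T (fun _ => (1 : ℝ)) p.1 * trunc T k p.2 * (C * h) ^ 2
      ∂(volume.prod volume) = T * (∫ s, trunc T k s) * (C * h) ^ 2 := by
    rw [integral_mul_const, integral_prod_mul (trunc T fun _ => (1 : ℝ)) (trunc T k)]
    congr 2
    rw [trunc, integral_indicator measurableSet_Ioo]
    simp [hT.le]
  simp_rw [mul_assoc h] at e1 e2
  rw [integral_const_mul] at e1 e2
  rw [e2', e4, e3] at hmono
  linarith

end Core

/-! ### Lower semicontinuity of the energy -/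

section Energy

variable {H : Type*} [NormedAddCommGroup H]

lemma liminf_add_liminf_le {a b c : ℕ → ℝ≥0∞} {c₀ : ℝ≥0∞} (h : ∀ n, a n + b n ≤ c n)
    (hc : Tendsto c atTop (𝓝 c₀)) : liminf a atTop + liminf b atTop ≤ c₀ := by
  rw [liminf_eq_iSup_iInf_of_nat, liminf_eq_iSup_iInf_of_nat, ENNReal.iSup_add_iSup_of_monotone]
  · refine iSup_le fun n => ge_of_tendsto hc ?_
    filter_upwards [eventually_ge_atTop n] with i hi
    exact (add_le_add (iInf₂_le i hi) (iInf₂_le i hi)).trans (h i)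
  all_goals exact fun m n hmn => le_iInf₂ fun i hi => iInf₂_le i (hmn.trans hi)

/-- The sum of the two weighted integrals of `G`, with weights `α` and `β`, as an extended
nonnegative real, so that its finiteness need not be known beforehand. -/
noncomputable def energy (T : ℝ) (α β : ℝ → ℝ) (G : ℝ → H) : ℝ≥0∞ :=
  (∫⁻ t in Ioo 0 T, ENNReal.ofReal ((α (T - t) + α t) * ‖G t‖ ^ 2)) +
    ∫⁻ p in triangle T, ENNReal.ofReal (β p.2 * ‖G p.1 - G (p.1 - p.2)‖ ^ 2)

lemma ae_comp_sub {P : ℝ → ℝ → Prop} {p : ℝ → Prop} (h : ∀ᵐ t, p t)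
    (hP : ∀ s t, p s → p t → P s t) :
    ∀ᵐ q : ℝ × ℝ, P q.1 (q.1 - q.2) := by
  have h1 : ∀ᵐ q : ℝ × ℝ ∂(volume.prod volume), p q.1 := Measure.quasiMeasurePreserving_fst.ae h
  have h2 : ∀ᵐ q : ℝ × ℝ ∂(volume.prod volume), p (q.1 - q.2) :=
    (quasiMeasurePreserving_sub_of_right_invariant volume volume).ae h
  filter_upwards [h1, h2] with q hq1 hq2
  exact hP _ _ hq1 hq2

lemma aestronglyMeasurable_increment {G : ℝ → H} (hG : AEStronglyMeasurable G) :
    AEStronglyMeasurable fun q : ℝ × ℝ => G q.1 - G (q.1 - q.2) := by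
  have h1 : AEStronglyMeasurable (fun q : ℝ × ℝ => G q.1) (volume.prod volume) := hG.comp_fst
  have h2 : AEStronglyMeasurable (fun q : ℝ × ℝ => G (q.1 - q.2)) (volume.prod volume) :=
    hG.comp_quasiMeasurePreserving (quasiMeasurePreserving_sub_of_right_invariant volume volume)
  exact h1.sub h2

/-- The energy is lower semicontinuous with respect to almost everywhere convergence. -/
lemma energy_le_of_tendsto {T : ℝ} {α β : ℕ → ℝ → ℝ} {α₀ β₀ : ℝ → ℝ} {G : ℕ → ℝ → H}
    {G₀ : ℝ → H} {c : ℕ → ℝ≥0∞} {c₀ : ℝ≥0∞} (hα : ∀ n, Measurable (α n))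
    (hβ : ∀ n, Measurable (β n)) (hG : ∀ n, AEStronglyMeasurable (G n))
    (hα' : ∀ t, 0 < t → Tendsto (fun n => α n t) atTop (𝓝 (α₀ t)))
    (hβ' : ∀ t, 0 < t → Tendsto (fun n => β n t) atTop (𝓝 (β₀ t)))
    (hG' : ∀ᵐ t, Tendsto (fun n => G n t) atTop (𝓝 (G₀ t)))
    (hc : ∀ n, energy T (α n) (β n) (G n) ≤ c n) (hc' : Tendsto c atTop (𝓝 c₀)) :
    energy T α₀ β₀ G₀ ≤ c₀ := by
  have m1 : ∀ n, AEMeasurable (fun t => ENNReal.ofReal ((α n (T - t) + α n t) * ‖G n t‖ ^ 2))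
      (volume.restrict (Ioo 0 T)) := fun n =>
    (((((hα n).comp (measurable_const.sub measurable_id)).add (hα n)).aemeasurable.mul
      ((hG n).norm.aemeasurable.pow_const 2)).ennreal_ofReal).restrict
  have m2 : ∀ n, AEMeasurable
      (fun p : ℝ × ℝ => ENNReal.ofReal (β n p.2 * ‖G n p.1 - G n (p.1 - p.2)‖ ^ 2))
      (volume.restrict (triangle T)) := fun n =>
    ((((hβ n).comp measurable_snd).aemeasurable.mul
      ((aestronglyMeasurable_increment (hG n)).norm.aemeasurable.pow_const
        2)).ennreal_ofReal).restrict
  have l1 := lintegral_liminf_le' m1 (u := atTop)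
  have l2 := lintegral_liminf_le' m2 (u := atTop)
  have e1 : ∫⁻ t in Ioo 0 T, ENNReal.ofReal ((α₀ (T - t) + α₀ t) * ‖G₀ t‖ ^ 2) =
      ∫⁻ t in Ioo 0 T, liminf
        (fun n => ENNReal.ofReal ((α n (T - t) + α n t) * ‖G n t‖ ^ 2)) atTop := by
    refine setLIntegral_congr_fun_ae measurableSet_Ioo ?_
    filter_upwards [hG'] with t ht htT
    refine (Tendsto.liminf_eq (ENNReal.tendsto_ofReal ?_)).symm
    exact ((hα' _ (by linarith [htT.2])).add (hα' t htT.1)).mul (ht.norm.pow 2)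
  have e2 : ∫⁻ p in triangle T, ENNReal.ofReal (β₀ p.2 * ‖G₀ p.1 - G₀ (p.1 - p.2)‖ ^ 2) =
      ∫⁻ p in triangle T, liminf
        (fun n => ENNReal.ofReal (β n p.2 * ‖G n p.1 - G n (p.1 - p.2)‖ ^ 2)) atTop := by
    refine setLIntegral_congr_fun_ae (measurableSet_triangle T) ?_
    filter_upwards [ae_comp_sub (P := fun s t => Tendsto (fun n => G n s) atTop (𝓝 (G₀ s)) ∧
      Tendsto (fun n => G n t) atTop (𝓝 (G₀ t))) hG' fun s t hs ht => ⟨hs, ht⟩] with p hp hpT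
    refine (Tendsto.liminf_eq (ENNReal.tendsto_ofReal ?_)).symm
    exact (hβ' _ hpT.1).mul ((hp.1.sub hp.2).norm.pow 2)
  rw [energy, e1, e2]
  refine (add_le_add l1 l2).trans ?_
  exact liminf_add_liminf_le hc hc'

lemma tendsto_indicator_Ioi (α : ℝ → ℝ) {t : ℝ} (ht : 0 < t) :
    Tendsto (fun n : ℕ => (Ioi (1 / ((n : ℝ) + 1))).indicator α t) atTop (𝓝 (α t)) := by
  refine tendsto_const_nhds.congr' ?_
  filter_upwards [tendsto_one_div_add_atTop_nhds_zero_nat.eventually (gt_mem_nhds ht)] with n hn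
  rw [indicator_of_mem (mem_Ioi.2 hn)]

end Energy

/-! ### The energy estimate for Lipschitz functions -/

section EnergyLe

variable {H : Type*} [NormedAddCommGroup H] [InnerProductSpace ℝ H] [CompleteSpace H]
  {k L : ℝ → ℝ} {y : ℝ → H} {B C T h : ℝ}

/-- The energy estimate with the weights cut off below `h` and an error of order `h`. -/
lemma energy_indicator_le (hkm : Measurable k) (hk0 : ∀ t, 0 < t → 0 ≤ k t)
    (hk : AntitoneOn k (Ioi 0)) (hkc : ConvexOn ℝ (Ioi 0) k) (hT : 0 < T)
    (hK : Integrable (trunc T k)) (hL : Integrable L) (hL0 : ∀ s ≤ 0, L s = 0)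
    (hKL : ∀ᵐ s, s < T → (trunc T k ⋆[lsmul ℝ ℝ, volume] L) s = trunc T (fun _ => (1 : ℝ)) s)
    (hC : ∀ s t, ‖y s - y t‖ ≤ C * |s - t|) (hB : ∀ t, ‖y t‖ ≤ B) (hyT : ∀ t, T ≤ t → y t = 0)
    (hh : 0 < h) :
    0 ≤ 2 * (∫ t in Ioo 0 T, inner ℝ (corr L y t) (y t)) +
        (2 * (T * ((∫ s, ‖L s‖) * B * C)) +
          T * (∫ s, trunc T k s) * ((∫ s, ‖L s‖) * C) ^ 2) * h ∧
    energy T ((Ioi h).indicator k) ((Ioi h).indicator (slopeWeight k)) (corr L y) ≤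
      ENNReal.ofReal (2 * (∫ t in Ioo 0 T, inner ℝ (corr L y t) (y t)) +
        (2 * (T * ((∫ s, ‖L s‖) * B * C)) +
          T * (∫ s, trunc T k s) * ((∫ s, ‖L s‖) * C) ^ 2) * h) := by
  have hy := continuous_of_norm_sub_le hC
  have hG := continuous_corr hL hy hB hC
  have hGB := norm_corr_le hL hB
  have hGC := norm_corr_sub_le hL hy hB hC
  have hGT : ∀ t, T ≤ t → corr L y t = 0 := fun t => corr_eq_zero_of_le hL0 hyT
  set G := corr L y with hGdef
  set M := ∫ s, ‖L s‖ with hM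
  have hMB : 0 ≤ M * B := (norm_nonneg _).trans (hGB 0)
  have hcore := integral_weights_le hkm hk0 hk hkc hT hK hh hG hGB hGT hGC
  rw [integral_diffKernel_mul_inner hT hK hL hKL hC hB hyT hh.le (c := M * B * (M * B)) (by
      have : Continuous fun p : ℝ × ℝ => inner ℝ (corr L y p.1) (corr L y (p.1 + p.2)) := by
        exact (hG.comp continuous_fst).inner (hG.comp (continuous_fst.add continuous_snd))
      exact this.measurable)
    (fun s t => (abs_real_inner_le_norm _ _).trans
      (mul_le_mul (hGB s) (hGB t) (norm_nonneg _) hMB))] at hcore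
  -- the mean of `y` over `(t, t + h)` is within `C h` of `y t`
  have hmean : ∫ t in Ioo 0 T, inner ℝ (G t) (∫ r in t..(t + h), y r) ≤
      h * (∫ t in Ioo 0 T, inner ℝ (G t) (y t)) + T * (M * B * C) * h ^ 2 := by
    have hpw : ∀ t, inner ℝ (G t) (∫ r in t..(t + h), y r) ≤
        h * inner ℝ (G t) (y t) + M * B * C * h ^ 2 := by
      intro t
      have h1 : ∫ r in t..(t + h), y r = h • y t + ∫ r in t..(t + h), (y r - y t) := by
        rw [intervalIntegral.integral_sub (hy.intervalIntegrable _ _) intervalIntegrable_const,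
          intervalIntegral.integral_const, add_sub_cancel_left, add_sub_cancel]
      have h2 : ‖∫ r in t..(t + h), (y r - y t)‖ ≤ C * h * h := by
        have h3 := intervalIntegral.norm_integral_le_of_norm_le_const (a := t) (b := t + h)
          (f := fun r => y r - y t) (C := C * h) fun r hr => by
            rw [uIoc_of_le (by linarith)] at hr
            have h4 := hC r t
            rw [abs_of_pos (by linarith [hr.1])] at h4
            have h5 : 0 < r - t := by linarith [hr.1]
            have hC0 : 0 ≤ C := by
              by_contra! hC'
              have := (norm_nonneg _).trans h4
              nlinarith
            exact h4.trans (by gcongr; linarith [hr.2])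
        rwa [add_sub_cancel_left, abs_of_pos hh] at h3
      rw [h1, inner_add_right, real_inner_smul_right]
      have h6 := (real_inner_le_norm (G t) (∫ r in t..(t + h), (y r - y t))).trans
        (mul_le_mul (hGB t) h2 (norm_nonneg _) hMB)
      linarith
    have hci : IntegrableOn (fun t => inner ℝ (G t) (y t)) (Ioo 0 T) :=
      (by fun_prop : Continuous fun t => inner ℝ (G t) (y t)).integrableOn_Icc.mono_set
        Ioo_subset_Icc_self
    have hci' : IntegrableOn (fun t => inner ℝ (G t) (∫ r in t..(t + h), y r)) (Ioo 0 T) := by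
      have hcont : Continuous fun t => ∫ r in t..(t + h), y r := by
        have h7 : ∀ t, ∫ r in t..(t + h), y r =
            (∫ r in (0 : ℝ)..(t + h), y r) - ∫ r in (0 : ℝ)..t, y r := fun t =>
          (intervalIntegral.integral_interval_sub_left (hy.intervalIntegrable _ _)
            (hy.intervalIntegrable _ _)).symm
        simp_rw [h7]
        have h8 := intervalIntegral.continuous_primitive
          (fun a b => hy.intervalIntegrable (μ := volume) a b) 0
        exact (h8.comp (continuous_add_const h)).sub h8
      exact (hG.inner hcont).integrableOn_Icc.mono_set Ioo_subset_Icc_self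
    refine (setIntegral_mono hci' ((hci.const_mul h).add
      (integrableOn_const (C := M * B * C * h ^ 2) (by simp))) hpw).trans (le_of_eq ?_)
    rw [integral_add' (hci.const_mul h) (integrableOn_const (by simp)), integral_const_mul,
      setIntegral_const]
    simp [hT.le]
    ring
  have hkh : ∀ s, 0 ≤ (Ioi h).indicator k s := fun s =>
    indicator_nonneg (fun s hs => hk0 s (hh.trans hs)) s
  have hkh' : ∀ s, (Ioi h).indicator k s ≤ k h := fun s => by
    refine indicator_le' (fun s hs => ?_) (fun s _ => hk0 h hh) s
    exact hk hh (hh.trans hs) (le_of_lt hs)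
  have hb0 : ∀ s, 0 ≤ (Ioi h).indicator (slopeWeight k) s := fun s =>
    indicator_nonneg (fun s hs => slopeWeight_nonneg hk (hh.trans hs)) _
  have hb1 : ∀ s, (Ioi h).indicator (slopeWeight k) s ≤ 1 / h * k h := fun s =>
    indicator_le' (fun s hs => slopeWeight_le hk0 hk hh hs)
      (fun s _ => mul_nonneg (by positivity) (hk0 h hh)) _
  have hGsq : ∀ t, ‖G t‖ ^ 2 ≤ (M * B) ^ 2 := fun t => by
    gcongr
    exact hGB t
  have hkhm : Measurable ((Ioi h).indicator k) := hkm.indicator measurableSet_Ioi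
  have j : ∀ r : ℝ → ℝ, Measurable r →
      IntegrableOn (fun t => (Ioi h).indicator k (r t) * ‖G t‖ ^ 2) (Ioo 0 T) := by
    intro r hr
    refine IntegrableOn.of_bound (by simp)
      ((hkhm.comp hr).mul (hG.norm.pow 2).measurable).aestronglyMeasurable (k h * (M * B) ^ 2)
      (.of_forall fun t => ?_)
    rw [Real.norm_of_nonneg (mul_nonneg (hkh _) (sq_nonneg _))]
    exact mul_le_mul (hkh' _) (hGsq t) (sq_nonneg _) (hk0 h hh)
  have j1 := j (fun t => T - t) (by fun_prop)
  have j2 := j (fun t => t) measurable_id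
  have j3 : IntegrableOn (fun p : ℝ × ℝ => (Ioi h).indicator (slopeWeight k) p.2 *
      ‖G p.1 - G (p.1 - p.2)‖ ^ 2) (triangle T) := by
    have hm : Measurable ((Ioi h).indicator (slopeWeight k)) :=
      (measurable_slopeWeight hkm).indicator measurableSet_Ioi
    have hGm : Continuous fun q : ℝ × ℝ => ‖G q.1 - G (q.1 - q.2)‖ ^ 2 := by fun_prop
    refine IntegrableOn.of_bound (volume_triangle_lt_top T)
      ((hm.comp measurable_snd).mul hGm.measurable).aestronglyMeasurable
      (1 / h * k h * (M * B + M * B) ^ 2) (.of_forall fun q => ?_)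
    rw [Real.norm_of_nonneg (mul_nonneg (hb0 _) (sq_nonneg _))]
    have h3 := (norm_sub_le (G q.1) (G (q.1 - q.2))).trans (add_le_add (hGB _) (hGB _))
    have h4 := (hb0 q.2).trans (hb1 q.2)
    gcongr
    exact hb1 _
  have hn1 : 0 ≤ ∫ t in Ioo 0 T,
      ((Ioi h).indicator k (T - t) + (Ioi h).indicator k t) * ‖G t‖ ^ 2 :=
    integral_nonneg fun t => mul_nonneg (add_nonneg (hkh _) (hkh _)) (sq_nonneg _)
  have hn2 : 0 ≤ ∫ p in triangle T, (Ioi h).indicator (slopeWeight k) p.2 *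
      ‖G p.1 - G (p.1 - p.2)‖ ^ 2 :=
    integral_nonneg fun p => mul_nonneg (hb0 _) (sq_nonneg _)
  have j12 : IntegrableOn (fun t => ((Ioi h).indicator k (T - t) + (Ioi h).indicator k t) *
      ‖G t‖ ^ 2) (Ioo 0 T) := by
    refine (j1.add j2).congr (.of_forall fun t => ?_)
    simp [add_mul]
  rw [energy, ← ofReal_integral_eq_lintegral_ofReal j12
      (.of_forall fun t => mul_nonneg (add_nonneg (hkh _) (hkh _)) (sq_nonneg _)),
    ← ofReal_integral_eq_lintegral_ofReal j3
      (.of_forall fun p => mul_nonneg (hb0 _) (sq_nonneg _)), ← ENNReal.ofReal_add hn1 hn2]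
  suffices hreal : _ ≤ _ from ⟨(add_nonneg hn1 hn2).trans hreal, ENNReal.ofReal_le_ofReal hreal⟩
  refine le_of_mul_le_mul_left ?_ hh
  simp_rw [add_mul]
  rw [integral_add j1 j2]
  nlinarith [hcore, hmean]

/-- The energy estimate for Lipschitz `y`, by letting `h → 0` in `energy_indicator_le`. -/
lemma energy_le_of_lipschitz (hkm : Measurable k) (hk0 : ∀ t, 0 < t → 0 ≤ k t)
    (hk : AntitoneOn k (Ioi 0)) (hkc : ConvexOn ℝ (Ioi 0) k) (hT : 0 < T)
    (hK : Integrable (trunc T k)) (hL : Integrable L) (hL0 : ∀ s ≤ 0, L s = 0)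
    (hKL : ∀ᵐ s, s < T → (trunc T k ⋆[lsmul ℝ ℝ, volume] L) s = trunc T (fun _ => (1 : ℝ)) s)
    (hC : ∀ s t, ‖y s - y t‖ ≤ C * |s - t|) (hB : ∀ t, ‖y t‖ ≤ B) (hyT : ∀ t, T ≤ t → y t = 0) :
    0 ≤ 2 * ∫ t in Ioo 0 T, inner ℝ (corr L y t) (y t) ∧
    energy T k (slopeWeight k) (corr L y) ≤
      ENNReal.ofReal (2 * ∫ t in Ioo 0 T, inner ℝ (corr L y t) (y t)) := by
  have hG := continuous_corr hL (continuous_of_norm_sub_le hC) hB hC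
  have hh := fun n : ℕ => energy_indicator_le hkm hk0 hk hkc hT hK hL hL0 hKL hC hB hyT
    (Nat.one_div_pos_of_nat (n := n))
  have hlim : Tendsto (fun n : ℕ => 2 * (∫ t in Ioo 0 T, inner ℝ (corr L y t) (y t)) +
      (2 * (T * ((∫ s, ‖L s‖) * B * C)) + T * (∫ s, trunc T k s) * ((∫ s, ‖L s‖) * C) ^ 2) *
        (1 / ((n : ℝ) + 1))) atTop (𝓝 (2 * ∫ t in Ioo 0 T, inner ℝ (corr L y t) (y t))) := by
    simpa using ((tendsto_one_div_add_atTop_nhds_zero_nat (𝕜 := ℝ)).const_mul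
      (2 * (T * ((∫ s, ‖L s‖) * B * C)) +
        T * (∫ s, trunc T k s) * ((∫ s, ‖L s‖) * C) ^ 2)).const_add
      (2 * ∫ t in Ioo 0 T, inner ℝ (corr L y t) (y t))
  refine ⟨ge_of_tendsto' hlim fun n => (hh n).1, ?_⟩
  exact energy_le_of_tendsto (G := fun _ => corr L y)
    (fun n : ℕ => hkm.indicator (measurableSet_Ioi (a := 1 / ((n : ℝ) + 1))))
    (fun n : ℕ => (measurable_slopeWeight hkm).indicator
      (measurableSet_Ioi (a := 1 / ((n : ℝ) + 1)))) (fun _ => hG.aestronglyMeasurable)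
    (fun t => tendsto_indicator_Ioi k) (fun t => tendsto_indicator_Ioi _)
    (.of_forall fun t => tendsto_const_nhds)
    (fun n => (hh n).2) (ENNReal.tendsto_ofReal hlim)

end EnergyLe

/-! ### Approximation by Lipschitz functions -/

section Density

variable {H : Type*} [NormedAddCommGroup H] [InnerProductSpace ℝ H] {T : ℝ} {y : ℝ → H}

/-- Lipschitz functions that vanish on `[T, ∞)` are dense in the `L²` functions that do. -/
lemma exists_lipschitz_eLpNorm_sub_le (hy : MemLp y 2) (hyT : ∀ t, T ≤ t → y t = 0) {ε : ℝ}
    (hε : 0 < ε) :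
    ∃ (z : ℝ → H) (B C : ℝ), (∀ s t, ‖z s - z t‖ ≤ C * |s - t|) ∧ (∀ t, ‖z t‖ ≤ B) ∧
      (∀ t, T ≤ t → z t = 0) ∧ MemLp z 2 ∧ eLpNorm (z - y) 2 volume ≤ ENNReal.ofReal ε := by
  obtain ⟨δ, hδ, hδy⟩ := hy.eLpNorm_indicator_le (by norm_num) (by norm_num) (half_pos hε)
  have hy1 : MemLp ((Iio (T - δ)).indicator y) 2 := hy.indicator measurableSet_Iio
  obtain ⟨g, hgk, hgc, hgy⟩ := hy1.exist_eLpNorm_sub_le (by norm_num) (by norm_num) (half_pos hε)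
  obtain ⟨C, hC⟩ := hgc.lipschitzWith_of_hasCompactSupport hgk (by simp)
  obtain ⟨B, hB⟩ := hgk.exists_bound_of_continuous hgc.continuous
  -- a cut-off equal to `1` up to `T - δ` and to `0` from `T` on
  set χ : ℝ → ℝ := fun t => max (min ((T - t) / δ) 1) 0 with hχ
  have hχ0 : ∀ t, 0 ≤ χ t := fun t => le_max_right _ _
  have hχ1 : ∀ t, χ t ≤ 1 := fun t => max_le (min_le_right _ _) zero_le_one
  have hχc : Continuous χ := by fun_prop
  have hχL : ∀ s t, |χ s - χ t| ≤ |s - t| / δ := by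
    intro s t
    refine (abs_max_sub_max_le_abs _ _ _).trans ((abs_min_sub_min_le_max _ _ _ _).trans ?_)
    rw [sub_self, abs_zero, max_eq_left (abs_nonneg _), ← sub_div, abs_div, abs_of_pos hδ]
    simp [abs_sub_comm]
  have hχT : ∀ t, T ≤ t → χ t = 0 := fun t ht => by
    refine max_eq_right ((min_le_left _ _).trans ?_)
    exact div_nonpos_of_nonpos_of_nonneg (by linarith) hδ.le
  have hχδ : ∀ t, t < T - δ → χ t = 1 := fun t ht => by
    have h1 : 1 ≤ (T - t) / δ := by
      rw [le_div_iff₀ hδ]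
      linarith
    simp [hχ, min_eq_right h1]
  have hz : MemLp (fun t => χ t • g t) 2 :=
    (hχc.smul hgc.continuous).memLp_of_hasCompactSupport hgk.smul_left
  refine ⟨fun t => χ t • g t, B, B / δ + C, fun s t => ?_, fun t => ?_, fun t ht => ?_, hz, ?_⟩
  · have h1 : χ s • g s - χ t • g t = (χ s - χ t) • g s + χ t • (g s - g t) := by module
    rw [h1]
    refine (norm_add_le _ _).trans ?_
    rw [norm_smul, norm_smul, Real.norm_eq_abs, Real.norm_eq_abs, abs_of_nonneg (hχ0 t)]
    have h2 : ‖g s - g t‖ ≤ C * |s - t| := by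
      have := hC.dist_le_mul s t
      rwa [dist_eq_norm, Real.dist_eq] at this
    calc |χ s - χ t| * ‖g s‖ + χ t * ‖g s - g t‖
        ≤ |s - t| / δ * B + 1 * (C * |s - t|) := by
          gcongr
          · exact hχL s t
          · exact hB s
          · exact hχ1 t
      _ = (B / δ + C) * |s - t| := by ring
  · rw [norm_smul, Real.norm_of_nonneg (hχ0 t)]
    exact (mul_le_of_le_one_left (norm_nonneg _) (hχ1 t)).trans (hB t)
  · simp [hχT t ht]
  · have h1 : (fun t => χ t • g t) - y =
        ((fun t => χ t • g t) - (Iio (T - δ)).indicator y) - (Ico (T - δ) T).indicator y := by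
      ext t
      simp only [Pi.sub_apply]
      rcases lt_or_ge t (T - δ) with h | h
      · rw [indicator_of_mem (mem_Iio.2 h), indicator_of_notMem fun h' => absurd h'.1 (not_le.2 h),
          sub_zero]
      · rw [indicator_of_notMem (by simpa using h), sub_zero]
        rcases lt_or_ge t T with h2 | h2
        · rw [indicator_of_mem (show t ∈ Ico (T - δ) T from ⟨h, h2⟩)]
        · rw [indicator_of_notMem fun h' => absurd h'.2 (not_lt.2 h2), hyT t h2]
    rw [h1]
    refine (eLpNorm_sub_le (hz.sub hy1).aestronglyMeasurable
      (hy.indicator measurableSet_Ico).aestronglyMeasurable (by norm_num)).trans ?_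
    rw [← add_halves ε, ENNReal.ofReal_add (half_pos hε).le (half_pos hε).le]
    refine add_le_add ?_ (hδy _ measurableSet_Ico (by simp))
    refine le_trans ?_ hgy
    rw [eLpNorm_sub_comm]
    refine eLpNorm_mono fun t => ?_
    have h2 : ((Iio (T - δ)).indicator y - fun t => χ t • g t) t =
        χ t • ((Iio (T - δ)).indicator y - g) t := by
      simp only [Pi.sub_apply, smul_sub]
      congr 1
      by_cases h : t < T - δ
      · rw [hχδ t h, one_smul]
      · rw [indicator_of_notMem (by simpa using h), smul_zero]
    rw [h2, norm_smul, Real.norm_of_nonneg (hχ0 t)]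
    exact mul_le_of_le_one_left (norm_nonneg _) (hχ1 t)

lemma tendsto_integral_inner {μ : Measure ℝ} {f g : ℕ → ℝ → H} {f₀ g₀ : ℝ → H}
    (hf : ∀ n, MemLp (f n) 2 μ) (hg : ∀ n, MemLp (g n) 2 μ) (hf₀ : MemLp f₀ 2 μ)
    (hg₀ : MemLp g₀ 2 μ) (hff : Tendsto (fun n => eLpNorm (f n - f₀) 2 μ) atTop (𝓝 0))
    (hgg : Tendsto (fun n => eLpNorm (g n - g₀) 2 μ) atTop (𝓝 0)) :
    Tendsto (fun n => ∫ t, inner ℝ (f n t) (g n t) ∂μ) atTop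
      (𝓝 (∫ t, inner ℝ (f₀ t) (g₀ t) ∂μ)) := by
  have h : ∀ {a b : ℝ → H} (ha : MemLp a 2 μ) (hb : MemLp b 2 μ),
      inner ℝ (ha.toLp a) (hb.toLp b) = ∫ t, inner ℝ (a t) (b t) ∂μ := by
    intro a b ha hb
    rw [L2.inner_def]
    refine integral_congr_ae ?_
    filter_upwards [ha.coeFn_toLp, hb.coeFn_toLp] with t h1 h2
    rw [h1, h2]
  have h1 := (Lp.tendsto_Lp_iff_tendsto_eLpNorm'' f hf f₀ hf₀).2 hff
  have h2 := (Lp.tendsto_Lp_iff_tendsto_eLpNorm'' g hg g₀ hg₀).2 hgg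
  have h3 := h1.inner (𝕜 := ℝ) h2
  simp_rw [h] at h3
  exact h3

end Density

/-! ### The energy estimate for square-integrable functions -/

section EnergyLe

variable {H : Type*} [NormedAddCommGroup H] [InnerProductSpace ℝ H] [CompleteSpace H]
  {k L : ℝ → ℝ} {y : ℝ → H} {T : ℝ}

/-- The energy estimate for square-integrable `y`. Its right-hand side is continuous in `L²` by
Young's inequality, and its left-hand side is lower semicontinuous. -/
lemma energy_le (hkm : Measurable k) (hk0 : ∀ t, 0 < t → 0 ≤ k t)
    (hk : AntitoneOn k (Ioi 0)) (hkc : ConvexOn ℝ (Ioi 0) k) (hT : 0 < T)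
    (hK : Integrable (trunc T k)) (hL : Integrable L) (hL0 : ∀ s ≤ 0, L s = 0)
    (hKL : ∀ᵐ s, s < T → (trunc T k ⋆[lsmul ℝ ℝ, volume] L) s = trunc T (fun _ => (1 : ℝ)) s)
    (hy : MemLp y 2) (hyi : Integrable y) (hyT : ∀ t, T ≤ t → y t = 0) :
    0 ≤ 2 * ∫ t in Ioo 0 T, inner ℝ (corr L y t) (y t) ∧
    energy T k (slopeWeight k) (corr L y) ≤
      ENNReal.ofReal (2 * ∫ t in Ioo 0 T, inner ℝ (corr L y t) (y t)) := by
  choose z B C hC hB hzT hz hzy using fun n : ℕ =>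
    exists_lipschitz_eLpNorm_sub_le hy hyT (Nat.one_div_pos_of_nat (α := ℝ) (n := n))
  have hlim : Tendsto (fun n => eLpNorm (z n - y) 2 volume) atTop (𝓝 0) := by
    refine tendsto_of_tendsto_of_tendsto_of_le_of_le tendsto_const_nhds ?_ (fun _ => zero_le) hzy
    have := ENNReal.tendsto_ofReal (tendsto_one_div_add_atTop_nhds_zero_nat (𝕜 := ℝ))
    simpa using this
  have hGz : ∀ n, MemLp (corr L (z n)) 2 := fun n => memLp_corr hL (hz n)
  have hGy : MemLp (corr L y) 2 := memLp_corr hL hy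
  have hsub : ∀ n, corr L (z n) - corr L y =ᵐ[volume] corr L (z n - y) := by
    intro n
    filter_upwards [ae_integrable_corr hL hyi] with t ht
    rw [Pi.sub_apply, corr, corr, corr, ← integral_sub (integrable_smul_comp_add hL
      (continuous_of_norm_sub_le (hC n)) (hB n) t) ht]
    simp only [Pi.sub_apply, smul_sub]
  have hGlim : Tendsto (fun n => eLpNorm (corr L (z n) - corr L y) 2 volume) atTop (𝓝 0) := by
    have h1 : Tendsto (fun n => eLpNorm L 1 volume * eLpNorm (z n - y) 2 volume) atTop (𝓝 0) := by
      have := ENNReal.Tendsto.const_mul (a := eLpNorm L 1 volume) hlim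
        (Or.inr (memLp_one_iff_integrable.2 hL).eLpNorm_ne_top)
      simpa using this
    refine tendsto_of_tendsto_of_tendsto_of_le_of_le tendsto_const_nhds h1 (fun _ => zero_le)
      fun n => ?_
    simp only
    rw [eLpNorm_congr_ae (hsub n)]
    exact eLpNorm_corr_le hL.aestronglyMeasurable ((hz n).sub hy).aestronglyMeasurable
  obtain ⟨ns, hns, hae⟩ := (tendstoInMeasure_of_tendsto_eLpNorm (by norm_num)
    (fun n => (hGz n).aestronglyMeasurable) hGy.aestronglyMeasurable hGlim).exists_seq_tendsto_ae
  have hrestr : ∀ f : ℕ → ℝ → H, Tendsto (fun n => eLpNorm (f n) 2 volume) atTop (𝓝 0) →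
      Tendsto (fun n => eLpNorm (f n) 2 (volume.restrict (Ioo 0 T))) atTop (𝓝 0) := fun f hf =>
    tendsto_of_tendsto_of_tendsto_of_le_of_le tendsto_const_nhds hf (fun _ => zero_le)
      fun n => eLpNorm_mono_measure _ Measure.restrict_le_self
  have hQ := tendsto_integral_inner (fun n => (hGz n).restrict (Ioo 0 T))
    (fun n => (hz n).restrict (Ioo 0 T)) (hGy.restrict _) (hy.restrict _)
    (hrestr (fun n => corr L (z n) - corr L y) hGlim) (hrestr (fun n => z n - y) hlim)
  have hlip := fun n => energy_le_of_lipschitz hkm hk0 hk hkc hT hK hL hL0 hKL (hC (ns n))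
    (hB (ns n)) (hzT (ns n))
  have hQ2 := (hQ.comp hns.tendsto_atTop).const_mul 2
  refine ⟨ge_of_tendsto' hQ2 fun n => (hlip n).1, ?_⟩
  exact energy_le_of_tendsto (fun _ => hkm) (fun _ => measurable_slopeWeight hkm)
    (fun n => (hGz (ns n)).aestronglyMeasurable) (fun t _ => tendsto_const_nhds)
    (fun t _ => tendsto_const_nhds) hae (fun n => (hlip n).2) (ENNReal.tendsto_ofReal hQ2)

end EnergyLe

/-! ### Correlation and convolution are adjoint -/

section Adjoint

variable {H : Type*} [NormedAddCommGroup H] [InnerProductSpace ℝ H]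

lemma integrable_inner_of_memLp {μ : Measure ℝ} {f g : ℝ → H} (hf : MemLp f 2 μ)
    (hg : MemLp g 2 μ) : Integrable (fun t => inner ℝ (f t) (g t)) μ := by
  have h : Integrable (fun t => ‖f t‖ * ‖g t‖) μ := hf.norm.integrable_mul hg.norm
  exact h.mono' (hf.aestronglyMeasurable.inner hg.aestronglyMeasurable)
    (.of_forall fun t => norm_inner_le_norm _ _)

/-- The correlation with `L` is the adjoint of the convolution with `L`. -/
lemma integral_inner_corr [CompleteSpace H] {L : ℝ → ℝ} {y : ℝ → H} (hL : Integrable L)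
    (hy : MemLp y 2) (hyi : Integrable y) :
    ∫ t, inner ℝ (corr L y t) (y t) = ∫ t, inner ℝ (y t) ((L ⋆[lsmul ℝ ℝ, volume] y) t) := by
  have hm : AEStronglyMeasurable (fun p : ℝ × ℝ => L p.2 • y (p.1 - p.2))
      (volume.prod volume) :=
    hL.aestronglyMeasurable.convolution_integrand (lsmul ℝ ℝ) hy.aestronglyMeasurable
  have hm' : AEStronglyMeasurable (fun p : ℝ × ℝ => inner ℝ (y p.1) (L p.2 • y (p.1 - p.2)))
      (volume.prod volume) := hy.aestronglyMeasurable.comp_fst.inner hm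
  have hex := hL.ae_convolution_exists (lsmul ℝ ℝ) hyi
  have hnorm : MemLp (fun t => ∫ s, ‖L s‖ * ‖y (t - s)‖) 2 := by
    simpa [convolution_def] using! memLp_convolution hL.norm hy.norm
  have hint : Integrable (fun p : ℝ × ℝ => inner ℝ (y p.1) (L p.2 • y (p.1 - p.2)))
      (volume.prod volume) := by
    rw [integrable_prod_iff hm']
    refine ⟨?_, ?_⟩
    · filter_upwards [hex] with t ht
      exact ht.integrable.const_inner (y t)
    · refine (hy.norm.integrable_mul hnorm).mono' hm'.norm.integral_prod_right' ?_
      filter_upwards [hex] with t ht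
      have hi : Integrable (fun s => ‖L s‖ * ‖y (t - s)‖) := by
        simpa [norm_smul] using ht.integrable.norm
      rw [Real.norm_of_nonneg (integral_nonneg fun _ => norm_nonneg _), Pi.mul_apply,
        ← integral_const_mul]
      refine integral_mono_of_nonneg (.of_forall fun _ => norm_nonneg _) (hi.const_mul _)
        (.of_forall fun s => ?_)
      refine (norm_inner_le_norm _ _).trans_eq ?_
      rw [norm_smul]
  have hint' : Integrable (fun p : ℝ × ℝ => inner ℝ (y (shear p).1)
      (L (shear p).2 • y ((shear p).1 - (shear p).2))) (volume.prod volume) :=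
    (measurePreserving_shear.integrable_comp_emb shear.measurableEmbedding).2 hint
  have hswap := measurePreserving_shear.integral_comp' (f := shear)
    (fun p : ℝ × ℝ => inner ℝ (y p.1) (L p.2 • y (p.1 - p.2)))
  rw [integral_prod _ hint, integral_prod _ hint'] at hswap
  calc ∫ t, inner ℝ (corr L y t) (y t)
      = ∫ t, ∫ s, inner ℝ (y (t + s)) (L s • y (t + s - s)) := by
        refine integral_congr_ae ?_
        filter_upwards [ae_integrable_corr hL hyi] with t ht
        rw [real_inner_comm, corr, ← integral_inner ht]
        refine integral_congr_ae (.of_forall fun s => ?_)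
        simp only [add_sub_cancel_right, inner_smul_right]
        rw [real_inner_comm]
    _ = ∫ t, ∫ s, inner ℝ (y t) (L s • y (t - s)) := hswap
    _ = _ := by
        refine integral_congr_ae ?_
        filter_upwards [hex] with t ht
        exact integral_inner ht.integrable (y t)

end Adjoint

/-! ### Completely monotone kernels -/

section Kernel

variable {k : ℝ → ℝ}

lemma IsCompletelyMonotone.convexOn (hk : IsCompletelyMonotone k) : ConvexOn ℝ (Ioi 0) k := by
  have hd : ContDiffOn ℝ ∞ (deriv k) (Ioi 0) :=
    ((contDiffOn_infty_iff_deriv_of_isOpen isOpen_Ioi).1 hk.contDiffOn).2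
  refine convexOn_of_deriv2_nonneg' (convex_Ioi 0)
    (hk.contDiffOn.differentiableOn (by simp)) (hd.differentiableOn (by simp)) fun t ht => ?_
  have := hk.sign 2 t ht
  rw [iteratedDeriv_eq_iterate] at this
  simpa using this

/-- A completely monotone kernel is regular on `(0, ∞)` only; extended by zero it is measurable on
the whole line. -/
lemma IsCompletelyMonotone.measurable_indicator (hk : IsCompletelyMonotone k) :
    Measurable ((Ioi 0).indicator k) := by
  classical
  rw [← piecewise_eq_indicator]
  exact hk.contDiffOn.continuousOn.measurable_piecewise continuousOn_const measurableSet_Ioi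

end Kernel

/-! ### The energy estimate in terms of the dual convolution -/

section Energy

variable {H : Type*} [NormedAddCommGroup H] [InnerProductSpace ℝ H] [CompleteSpace H]

/-- The energy inequality for a Sonine pair with completely monotone `k`, in terms of Bochner
integrals. -/
lemma integral_energy_le {k l : ℝ → ℝ} (hkl : IsPCPair k l) (hk : IsCompletelyMonotone k) {T : ℝ}
    (hT : 0 < T) {y : ℝ → H} (hy : MemLp y 2 (volume.restrict (Ioo 0 T))) :
    IntegrableOn (fun t => (k (T - t) + k t) * ‖dualConv T l y t‖ ^ 2) (Ioo 0 T) ∧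
    IntegrableOn (fun p : ℝ × ℝ => 1 / p.2 * (k p.2 - k (2 * p.2)) *
      ‖dualConv T l y p.1 - dualConv T l y (p.1 - p.2)‖ ^ 2) (triangle T) ∧
    (∫ t in Ioo 0 T, (k (T - t) + k t) * ‖dualConv T l y t‖ ^ 2) +
      (∫ p in triangle T, 1 / p.2 * (k p.2 - k (2 * p.2)) *
        ‖dualConv T l y p.1 - dualConv T l y (p.1 - p.2)‖ ^ 2) ≤
      2 * ∫ t in Ioo 0 T, inner ℝ (y t) (conv l y t) := by
  -- the kernel is replaced by a measurable one that agrees with it on `(0, ∞)`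
  set kp := (Ioi 0).indicator k with hkp
  have hkpe : ∀ t, 0 < t → kp t = k t := fun t ht => indicator_of_mem (mem_Ioi.2 ht) k
  have hslope : ∀ s, 0 < s → slopeWeight kp s = 1 / s * (k s - k (2 * s)) := by
    intro s hs
    rw [slopeWeight, hkpe s hs, hkpe (2 * s) (by linarith)]
  have htr : trunc T kp = trunc T k := by
    ext t
    by_cases ht : t ∈ Ioo 0 T
    · rw [trunc_of_mem _ ht, trunc_of_mem _ ht, hkpe t ht.1]
    · rw [trunc_of_notMem _ ht, trunc_of_notMem _ ht]
  have hkm : Measurable kp := hk.measurable_indicator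
  have hk0 : ∀ t, 0 < t → 0 ≤ kp t := fun t ht => by rw [hkpe t ht]; exact hkl.nonneg t ht
  have hka : AntitoneOn kp (Ioi 0) :=
    hkl.antitone.congr fun t ht => (hkpe t ht).symm
  have hkc : ConvexOn ℝ (Ioi 0) kp := hk.convexOn.congr fun t ht => (hkpe t ht).symm
  have hL : Integrable (trunc T l) :=
    integrable_trunc_of_locallyIntegrableOn hkl.locallyIntegrable_right T
  have hY : MemLp (trunc T y) 2 := memLp_trunc hy
  have hYi : Integrable (trunc T y) := integrable_trunc_of_memLp hy
  obtain ⟨hQ0, hE⟩ := energy_le hkm hk0 hka hkc hT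
    (by rw [htr]; exact integrable_trunc_of_locallyIntegrableOn hkl.locallyIntegrable_left T)
    hL (fun s hs => trunc_eq_zero_of_nonpos l hs) (by rw [htr]; exact hkl.convolution_trunc T)
    hY hYi (fun t ht => trunc_of_notMem y fun h => absurd h.2 (not_lt.2 ht))
  have hQ : ∫ t in Ioo 0 T, inner ℝ (corr (trunc T l) (trunc T y) t) (trunc T y t) =
      ∫ t in Ioo 0 T, inner ℝ (y t) (conv l y t) := by
    have h0 : ∀ t ∉ Ioo 0 T, trunc T y t = 0 := fun t ht => trunc_of_notMem y ht
    rw [setIntegral_eq_integral_of_forall_compl_eq_zero fun t ht => by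
        rw [h0 t ht, inner_zero_right],
      integral_inner_corr hL hY hYi,
      ← setIntegral_eq_integral_of_forall_compl_eq_zero (s := Ioo 0 T) fun t ht => by
        rw [h0 t ht, inner_zero_left]]
    refine setIntegral_congr_fun measurableSet_Ioo fun t ht => ?_
    simp only [conv_eq_convolution l y ht, trunc_of_mem y ht]
  rw [hQ] at hE hQ0
  set G := corr (trunc T l) (trunc T y) with hG
  have hGe : ∀ t ∈ Ioo 0 T, dualConv T l y t = G t := fun t ht => dualConv_eq_corr l y ht
  have hGm : AEStronglyMeasurable G :=
    aestronglyMeasurable_corr hL.aestronglyMeasurable hY.aestronglyMeasurable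
  set X : ℝ → ℝ := fun t => (kp (T - t) + kp t) * ‖G t‖ ^ 2 with hX
  set Y : ℝ × ℝ → ℝ := fun p => slopeWeight kp p.2 * ‖G p.1 - G (p.1 - p.2)‖ ^ 2 with hYd
  have hXe : EqOn X (fun t => (k (T - t) + k t) * ‖dualConv T l y t‖ ^ 2) (Ioo 0 T) := by
    intro t ht
    simp only [hX, hGe t ht, hkpe t ht.1, hkpe (T - t) (by linarith [ht.2])]
  have hYe : EqOn Y (fun p => 1 / p.2 * (k p.2 - k (2 * p.2)) *
      ‖dualConv T l y p.1 - dualConv T l y (p.1 - p.2)‖ ^ 2) (triangle T) := by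
    rintro p ⟨h1, h2, h3⟩
    simp only [hYd]
    rw [hslope _ h1, hGe p.1 ⟨h1.trans h2, h3⟩, hGe (p.1 - p.2) ⟨by linarith, by linarith⟩]
  have hXm : AEStronglyMeasurable X (volume.restrict (Ioo 0 T)) :=
    AEStronglyMeasurable.mul (by fun_prop) ((hGm.norm.pow 2).restrict)
  have hYm : AEStronglyMeasurable Y (volume.restrict (triangle T)) :=
    AEStronglyMeasurable.mul
      ((measurable_slopeWeight hkm).comp measurable_snd).aestronglyMeasurable
      (((aestronglyMeasurable_increment hGm).norm.pow 2).restrict)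
  have hX0 : 0 ≤ᵐ[volume.restrict (Ioo 0 T)] X := by
    refine (ae_restrict_iff' measurableSet_Ioo).2 (.of_forall fun t ht => ?_)
    exact mul_nonneg (add_nonneg (hk0 _ (by linarith [ht.2])) (hk0 _ ht.1)) (sq_nonneg _)
  have hY0 : 0 ≤ᵐ[volume.restrict (triangle T)] Y := by
    refine (ae_restrict_iff' (measurableSet_triangle T)).2 (.of_forall fun p hp => ?_)
    exact mul_nonneg (slopeWeight_nonneg hka hp.1) (sq_nonneg _)
  have hE' : (∫⁻ t in Ioo 0 T, ENNReal.ofReal (X t)) + ∫⁻ p in triangle T, ENNReal.ofReal (Y p) ≤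
      ENNReal.ofReal (2 * ∫ t in Ioo 0 T, inner ℝ (y t) (conv l y t)) := hE
  have hfin := hE'.trans_lt ENNReal.ofReal_lt_top
  have hXi : IntegrableOn X (Ioo 0 T) := (lintegral_ofReal_ne_top_iff_integrable hXm hX0).1
    (ne_top_of_le_ne_top hfin.ne le_self_add)
  have hYi : IntegrableOn Y (triangle T) := (lintegral_ofReal_ne_top_iff_integrable hYm hY0).1
    (ne_top_of_le_ne_top hfin.ne le_add_self)
  refine ⟨hXi.congr_fun hXe measurableSet_Ioo, hYi.congr_fun hYe (measurableSet_triangle T), ?_⟩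
  rw [← setIntegral_congr_fun measurableSet_Ioo hXe,
    ← setIntegral_congr_fun (measurableSet_triangle T) hYe]
  rw [← ofReal_integral_eq_lintegral_ofReal hXi hX0, ← ofReal_integral_eq_lintegral_ofReal hYi hY0,
    ← ENNReal.ofReal_add (integral_nonneg_of_ae hX0) (integral_nonneg_of_ae hY0)] at hE'
  exact (ENNReal.ofReal_le_ofReal_iff hQ0).1 hE'

/-- Fubini on the triangle `0 < s < t < T`. -/
lemma setIntegral_triangle {T : ℝ} (hT : 0 < T) {Y : ℝ × ℝ → ℝ} (hY : IntegrableOn Y (triangle T)) :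
    ∫ p in triangle T, Y p = ∫ t in (0 : ℝ)..T, ∫ s in (0 : ℝ)..t, Y (t, s) := by
  have hm := measurableSet_triangle T
  rw [← integral_indicator hm]
  rw [Measure.volume_eq_prod, integral_prod _ (by
    rw [← Measure.volume_eq_prod]; exact (integrable_indicator_iff hm).2 hY)]
  rw [intervalIntegral.integral_of_le hT.le, integral_Ioc_eq_integral_Ioo,
    ← integral_indicator measurableSet_Ioo]
  refine integral_congr_ae (.of_forall fun t => ?_)
  simp only
  by_cases ht : t ∈ Ioo 0 T
  · rw [indicator_of_mem ht, intervalIntegral.integral_of_le ht.1.le, integral_Ioc_eq_integral_Ioo,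
      ← integral_indicator measurableSet_Ioo]
    refine integral_congr_ae (.of_forall fun s => ?_)
    simp only [indicator, triangle, mem_Ioo, mem_ofPred_eq, ht.2, and_true]
  · rw [indicator_of_notMem ht]
    refine integral_eq_zero_of_ae (.of_forall fun s => ?_)
    refine indicator_of_notMem ?_ _
    rintro ⟨h1, h2, h3⟩
    exact ht ⟨h1.trans h2, h3⟩

end Energy

end DualityEstimate

open DualityEstimate in
theorem mainTheorem6
    {V H : Type*}
    [NormedAddCommGroup V] [InnerProductSpace ℝ V] [CompleteSpace V]
    [TopologicalSpace.SeparableSpace V]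
    [NormedAddCommGroup H] [InnerProductSpace ℝ H] [CompleteSpace H]
    [TopologicalSpace.SeparableSpace H]
    -- the dense continuous embedding of `V` into `H`
    (ι : V →L[ℝ] H) (hι_inj : Function.Injective ι) (hι_dense : DenseRange ι)
    -- the bounded symmetric form and its coercivity up to a shift
    (a : V →L[ℝ] V →L[ℝ] ℝ) (ha_symm : ∀ w v : V, a w v = a v w)
    (κ d : ℝ) (hκ : 0 < κ) (hd : 0 ≤ d)
    (ha : ∀ v : V, κ * ‖v‖ ^ 2 - d * ‖ι v‖ ^ 2 ≤ a v v)
    -- the kernels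
    (k l : ℝ → ℝ) (hkl : IsPCPair k l) (hk : IsCompletelyMonotone k)
    -- the data and the solution
    (T : ℝ) (hT : 0 < T) (u₀ : H)
    (f : ℝ → StrongDual ℝ V) (hf : MemLp f 2 (volume.restrict (Set.Ioo 0 T)))
    (w : ℝ → V) (hw : MemLp w 2 (volume.restrict (Set.Ioo 0 T)))
    (u : ℝ → H) (hu : MemLp u 2 (volume.restrict (Set.Ioo 0 T)))
    (hku : ∃ g : ℝ → H, ContinuousOn g (Set.Icc 0 T) ∧ g 0 = 0 ∧
      ∀ᵐ t ∂(volume.restrict (Set.Ioo 0 T)), conv k u t = g t)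
    (hsol : IsWeakSolution T ι a k u₀ f u w) :
    let G : ℝ → H := dualConv T l (fun τ => sqrtApply ι (shiftedForm ι a d) (w τ))
    IntegrableOn (fun t => (k (T - t) + k t) * ‖G t‖ ^ 2) (Set.Ioo 0 T) ∧
    IntegrableOn (fun p : ℝ × ℝ => 1 / p.2 * (k p.2 - k (2 * p.2)) * ‖G p.1 - G (p.1 - p.2)‖ ^ 2)
      {p : ℝ × ℝ | 0 < p.2 ∧ p.2 < p.1 ∧ p.1 < T} ∧
    (∫ t in (0 : ℝ)..T, inner ℝ (ι (w t)) (u t))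
      + 1 / 2 * (∫ t in (0 : ℝ)..T, (k (T - t) + k t) * ‖G t‖ ^ 2)
      + 1 / 2 * (∫ t in (0 : ℝ)..T, ∫ s in (0 : ℝ)..t,
          1 / s * (k s - k (2 * s)) * ‖G t - G (t - s)‖ ^ 2)
    ≤ (∫ t in (0 : ℝ)..T, inner ℝ u₀ (ι (w t)))
      + (∫ t in (0 : ℝ)..T, conv l f t (w t))
      + d * (∫ t in (0 : ℝ)..T, inner ℝ (ι (w t)) (conv l (fun τ => ι (w τ)) t)) := by
  intro G
  have hsymm : ∀ w v, shiftedForm ι a d w v = shiftedForm ι a d v w := fun w v => by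
    rw [shiftedForm_apply, shiftedForm_apply, ha_symm, real_inner_comm]
  have hcoer := isCoercive_shiftedForm hκ ha
  obtain ⟨S, hS⟩ := exists_clm_eq_sqrtApply hι_dense hι_inj hsymm hcoer
  have hSS : ∀ v v', inner ℝ (S v) (S v') = a v v' + d * inner ℝ (ι v) (ι v') := fun v v' => by
    rw [hS, hS, inner_sqrtApply hι_dense hι_inj hsymm hcoer, shiftedForm_apply]
  have hG : G = dualConv T l (fun τ => S (w τ)) := by simp only [hS, G]
  have hSw : MemLp (fun τ => S (w τ)) 2 (volume.restrict (Set.Ioo 0 T)) := S.comp_memLp' hw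
  have hιw : MemLp (fun τ => ι (w τ)) 2 (volume.restrict (Set.Ioo 0 T)) := ι.comp_memLp' hw
  have hl := hkl.locallyIntegrable_right
  have hwi : IntegrableOn w (Set.Ioo 0 T) := hw.integrable (by norm_num)
  obtain ⟨hX, hY, hXY⟩ := integral_energy_le hkl hk hT hSw
  rw [← hG] at hX hY hXY
  refine ⟨hX, hY, ?_⟩
  rw [setIntegral_triangle hT hY] at hXY
  have hIoo : ∀ φ : ℝ → ℝ, ∫ t in (0 : ℝ)..T, φ t = ∫ t in Set.Ioo 0 T, φ t := fun φ => by
    rw [intervalIntegral.integral_of_le hT.le, integral_Ioc_eq_integral_Ioo]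
  -- the equation tested with `w` itself, with `a` expressed through `A^{1/2}`
  have hae : ∀ᵐ t ∂(volume.restrict (Set.Ioo 0 T)),
      inner ℝ (ι (w t)) (u t) + inner ℝ (S (w t)) (conv l (fun τ => S (w τ)) t) =
      inner ℝ u₀ (ι (w t)) + conv l f t (w t) +
        d * inner ℝ (ι (w t)) (conv l (fun τ => ι (w τ)) t) := by
    rw [ae_restrict_iff' measurableSet_Ioo]
    filter_upwards [hsol.ae_inner_sub_self_eq hkl hT (hf.integrable (by norm_num)) hwi
        (hu.integrable (by norm_num)) hku,
      ae_map_conv S hl hwi, ae_map_conv ι hl hwi] with t h1 h2 h3 ht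
    have h1 := h1 ht
    rw [← h2 ht, ← h3 ht, hSS, ha_symm]
    rw [inner_sub_left, real_inner_comm] at h1
    linarith
  have i1 := integrable_inner_of_memLp hιw hu
  have i2 := integrable_inner_of_memLp hSw (memLp_conv hl hSw)
  have i3 := integrable_inner_of_memLp (memLp_const u₀) hιw
  have i4 : Integrable (fun t => conv l f t (w t)) (volume.restrict (Set.Ioo 0 T)) := by
    have hlf := memLp_conv hl hf
    have h := hlf.norm.integrable_mul hw.norm
    exact h.mono' ((ContinuousLinearMap.id ℝ (StrongDual ℝ V)).aestronglyMeasurable_comp₂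
      hlf.aestronglyMeasurable hw.aestronglyMeasurable)
      (.of_forall fun t => (conv l f t).le_opNorm _)
  have i5 := (integrable_inner_of_memLp hιw (memLp_conv hl hιw)).const_mul d
  have i34 : Integrable (fun t => inner ℝ u₀ (ι (w t)) + conv l f t (w t))
      (volume.restrict (Set.Ioo 0 T)) := i3.add i4
  have hint := integral_congr_ae hae
  rw [integral_add i1 i2, integral_add i34 i5, integral_add i3 i4,
    integral_const_mul] at hint
  simp only [← hIoo] at hint hXY
  linarith
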